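/- Let $K$ be a field with a nonzero derivation $\delta : K \to K$, let $F = \{x \in K : \delta(x) = 0\}$ be its field of constants, and assume that $K/F$ is finite. Let $\mathcal A^+ = K[X;\delta]$ be the ring of Ore polynomials (with $Xa = aX + \delta(a)$ for $a \in K$), and let $\mathcal A$ be its skew field of fractions. Let $Z$ be the minimal polynomial of $\delta$; it has coefficients in $F$ and $Z(X)$ is central in $\mathcal A^+$. Put $\mathcal C^+ = K[Z(X)]$ and $\mathcal Z^+ = F[Z(X)]$ (polynomial rings in the variable $Z(X)$) and $\mathcal Z = \mathrm{Frac}(\mathcal Z^+) \subset \mathcal C = \mathrm{Frac}(\mathcal C^+)$. For $f \in \mathcal A^+$, the reduced trace $T_{\mathrm{rd}}(f) \in \mathcal C^+$ is the trace of the $\mathcal C^+$-linear endomorphism $x \mapsto xf$ of the free left module $\mathcal A^+$. Every element of $\mathcal A$ can be written $D^{-1}P$ with $0 \neq D \in \mathcal Z^+$, $P \in \mathcal A^+$, and one sets $T_{\mathrm{rd}}(D^{-1}P) = D^{-1}T_{\mathrm{rd}}(P)$. Let $F^{s}$ be a separable closure of $F$, let $K^{s} = F^{s} \otimes_F K$ with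 the $F^s$-linear extension of $\delta$, and let $\mathcal A^{s,+} = K^{s}[X;\delta]$. For $z \in F^{s}$ put $N = Z(X) - z$ and $R_z = \mathcal A^{s,+}/N\mathcal A^{s,+}$, and define $T_{\mathrm{rd}}$ on $R_z$ as the trace of right multiplication on $R_z$ viewed as a left module over $K^s[Z(X)]/(N) = K^{s}$. A $z$-admissible isomorphism is an isomorphism of $K^s$-algebras $$\tau_z : \varprojlim_{m>0} \mathcal A^{s,+}/N^m\mathcal A^{s,+} \xrightarrow{\ \sim\ } R_z[[T]]$$ that sends $N$ to $T$ and induces the identity of $R_z$ modulo $N$ on the left and modulo $T$ on the right. (Here an isomorphism of $K^s$-algebras is a ring isomorphism that is the identity on $K^s$.) The composite $\mathcal A^+ \to \varprojlim_m \mathcal A^{s,+}/N^m\mathcal A^{s,+} \to R_z[[T]]$ extends uniquely to a ring homomorphism $\mathrm{TS}_z : \mathcal A \to R_z((T))$, and the skew residue $\mathrm{sres}_z(f) \in R_z$ of $f \in \mathcal A$ with respect to $\tau_z$ is the coefficient of $T^{-1}$ in $\mathrm{TS}_z(f)$. Then, for every $f \in \mathcal A$, one has $T_{\mathrm{rd}}(f)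 \in \mathcal Z$ and, for every $z \in F^{s}$ and every $z$-admissible isomorphism, $$T_{\mathrm{rd}}\big(\mathrm{sres}_z(f)\big) = \mathrm{res}_z\big(T_{\mathrm{rd}}(f)\, dZ(X)\big),$$ where, for $g \in \mathcal Z$ regarded as a rational function over $F$ in the variable $Z(X)$, $\mathrm{res}_z(g\, dZ(X)) \in F^s \subset K^s$ is the usual residue at $Z(X) = z$, i.e. the coefficient of $T^{-1}$ in the Laurent expansion of $g(z+T)$. Consequently, $T_{\mathrm{rd}}(\mathrm{sres}_z(f))$ does not depend on the choice of the $z$-admissible isomorphism. -/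

import Mathlib

noncomputable section

open scoped Polynomial TensorProduct nonZeroDivisors

namespace SkewResidue

/-! ### Ore polynomials with respect to a derivation -/

section OrePoly

variable {R : Type*} [CommRing R]

/-- Ore polynomials `R[X; id, δ]`: polynomials `∑ aᵢ Xⁱ` with coefficients written on the left.
The additive group is that of `R[X]`, the product is the one with `X a = a X + δ a`. -/
def OrePoly (_δ : Derivation ℤ R R) : Type _ := R[X]

/-- Evaluation `∑ aᵢ Xⁱ ↦ ∑ aᵢ uⁱ` at an additive endomorphism of an `R`-module. -/
def evalEnd {M : Type*} [AddCommGroup M] [Module R M] (u : Module.End ℤ M) :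
    R[X] →ₗ[R] Module.End ℤ M :=
  Polynomial.lsum fun i => LinearMap.toSpanSingleton R (Module.End ℤ M) (u ^ i)

theorem evalEnd_monomial {M : Type*} [AddCommGroup M] [Module R M] (u : Module.End ℤ M)
    (n : ℕ) (a : R) : evalEnd u (Polynomial.monomial n a) = a • u ^ n := by
  simp [evalEnd, Polynomial.lsum, Polynomial.sum_monomial_index]

/-- Left multiplication by `X` on Ore polynomials: `∑ aᵢ Xⁱ ↦ ∑ (aᵢ Xⁱ⁺¹ + δ(aᵢ) Xⁱ)`. -/
def leftX (δ : Derivation ℤ R R) : Module.End ℤ R[X] :=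
  LinearMap.mulLeft ℤ (Polynomial.X : R[X]) +
    (Polynomial.lsum fun i => ((Polynomial.monomial i).restrictScalars ℤ).comp δ.toLinearMap)

theorem leftX_monomial (δ : Derivation ℤ R R) (n : ℕ) (a : R) :
    leftX δ (Polynomial.monomial n a) =
      Polynomial.monomial (n + 1) a + Polynomial.monomial n (δ a) := by
  simp [leftX, Polynomial.lsum, Polynomial.sum_monomial_index, Polynomial.X_mul_monomial]

theorem coeff_leftX (δ : Derivation ℤ R R) (P : R[X]) (n : ℕ) :
    (leftX δ P).coeff n = (Polynomial.X * P).coeff n + δ (P.coeff n) := by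
  induction P using Polynomial.induction_on' with
  | add p q hp hq => simp only [map_add, Polynomial.coeff_add, hp, hq, mul_add]; abel
  | monomial m a =>
    rw [leftX_monomial, Polynomial.X_mul_monomial, Polynomial.coeff_add]
    congr 1
    simp only [Polynomial.coeff_monomial]
    split_ifs <;> simp

theorem leftX_smul (δ : Derivation ℤ R R) (a : R) (P : R[X]) :
    leftX δ (a • P) = a • leftX δ P + δ a • P := by
  ext n
  simp only [coeff_leftX, Polynomial.coeff_add, Polynomial.coeff_smul, smul_eq_mul,
    Derivation.leibniz, Polynomial.X_mul, smul_mul_assoc]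
  ring

/-- The product of Ore polynomials: `(∑ aᵢ Xⁱ) Q = ∑ aᵢ (X (X (⋯ (X Q))))`. -/
def oreMul (δ : Derivation ℤ R R) (P Q : R[X]) : R[X] := evalEnd (leftX δ) P Q

theorem evalEnd_leftX {δ : Derivation ℤ R R} {M : Type*} [AddCommGroup M] [Module R M]
    {u : Module.End ℤ M} (hu : ∀ (a : R) (x : M), u (a • x) = a • u x + δ a • x) (Q : R[X]) :
    evalEnd u (leftX δ Q) = u * evalEnd u Q := by
  induction Q using Polynomial.induction_on' with
  | add p q hp hq => simp only [map_add, hp, hq, mul_add]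
  | monomial m a =>
    ext x
    simp [leftX_monomial, evalEnd_monomial, hu, pow_succ']

theorem evalEnd_oreMul {δ : Derivation ℤ R R} {M : Type*} [AddCommGroup M] [Module R M]
    {u : Module.End ℤ M} (hu : ∀ (a : R) (x : M), u (a • x) = a • u x + δ a • x) (P Q : R[X]) :
    evalEnd u (oreMul δ P Q) = evalEnd u P * evalEnd u Q := by
  have key : ∀ i : ℕ, evalEnd u ((leftX δ ^ i) Q) = u ^ i * evalEnd u Q := by
    intro i
    induction i with
    | zero => simp
    | succ i ih => rw [pow_succ', Module.End.mul_apply, evalEnd_leftX hu, ih, pow_succ', mul_assoc]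
  induction P using Polynomial.induction_on' with
  | add p q hp hq =>
    simp only [oreMul, map_add, LinearMap.add_apply, add_mul] at hp hq ⊢
    rw [hp, hq]
  | monomial m a =>
    simp only [oreMul, evalEnd_monomial, LinearMap.smul_apply, map_smul, key, smul_mul_assoc]

theorem oreMul_monomial (δ : Derivation ℤ R R) (n : ℕ) (a : R) (Q : R[X]) :
    oreMul δ (Polynomial.monomial n a) Q = a • (leftX δ ^ n) Q := by
  simp [oreMul, evalEnd_monomial]

theorem oreMul_one (δ : Derivation ℤ R R) (P : R[X]) : oreMul δ P 1 = P := by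
  have key : ∀ i : ℕ, (leftX δ ^ i) (1 : R[X]) = Polynomial.monomial i 1 := by
    intro i
    induction i with
    | zero => simp
    | succ i ih => rw [pow_succ', Module.End.mul_apply, ih, leftX_monomial]; simp
  induction P using Polynomial.induction_on' with
  | add p q hp hq =>
    simp only [oreMul, map_add, LinearMap.add_apply] at hp hq ⊢
    rw [hp, hq]
  | monomial m a => rw [oreMul_monomial, key, Polynomial.smul_monomial, smul_eq_mul, mul_one]

theorem one_oreMul (δ : Derivation ℤ R R) (Q : R[X]) : oreMul δ 1 Q = Q := by
  rw [← Polynomial.monomial_zero_one, oreMul_monomial]; simp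

theorem oreMul_assoc (δ : Derivation ℤ R R) (P Q S : R[X]) :
    oreMul δ (oreMul δ P Q) S = oreMul δ P (oreMul δ Q S) := by
  have h := evalEnd_oreMul (leftX_smul δ) P Q
  exact LinearMap.congr_fun h S

theorem add_oreMul (δ : Derivation ℤ R R) (P Q S : R[X]) :
    oreMul δ (P + Q) S = oreMul δ P S + oreMul δ Q S := by
  simp only [oreMul, map_add, LinearMap.add_apply]

theorem zero_oreMul (δ : Derivation ℤ R R) (S : R[X]) : oreMul δ 0 S = 0 := by
  simp only [oreMul, map_zero, LinearMap.zero_apply]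

theorem smul_oreMul (δ : Derivation ℤ R R) (a : R) (P Q : R[X]) :
    oreMul δ (a • P) Q = a • oreMul δ P Q := by
  simp only [oreMul, map_smul, LinearMap.smul_apply]

instance (δ : Derivation ℤ R R) : AddCommGroup (OrePoly δ) := inferInstanceAs (AddCommGroup R[X])

instance (δ : Derivation ℤ R R) : Module R (OrePoly δ) := inferInstanceAs (Module R R[X])

instance instRingOrePoly (δ : Derivation ℤ R R) : Ring (OrePoly δ) where
  __ := (inferInstance : AddCommGroup (OrePoly δ))
  mul P Q := oreMul δ P Q
  one := (1 : R[X])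
  mul_assoc := oreMul_assoc δ
  one_mul := one_oreMul δ
  mul_one := oreMul_one δ
  zero_mul := zero_oreMul δ
  mul_zero P := map_zero (evalEnd (leftX δ) P)
  left_distrib P := map_add (evalEnd (leftX δ) P)
  right_distrib := add_oreMul δ

variable (δ : Derivation ℤ R R)

/-- A polynomial, regarded as an Ore polynomial with the same coefficients. -/
def ofPoly : R[X] ≃ₗ[R] OrePoly δ := LinearEquiv.refl R R[X]

theorem ofPoly_mul_ofPoly (P Q : R[X]) : ofPoly δ P * ofPoly δ Q = ofPoly δ (oreMul δ P Q) := rfl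

theorem ofPoly_one : ofPoly δ 1 = 1 := rfl

instance : IsScalarTower R (OrePoly δ) (OrePoly δ) where
  smul_assoc := smul_oreMul δ

/-- The constants `R → R[X; δ]`. -/
def oreC : R →+* OrePoly δ where
  toFun a := a • 1
  map_one' := one_smul _ _
  map_mul' a b := by rw [smul_mul_assoc, one_mul, mul_smul]
  map_zero' := zero_smul _ _
  map_add' a b := add_smul a b _

theorem oreC_mul (a : R) (P : OrePoly δ) : oreC δ a * P = a • P := by
  change (a • (1 : OrePoly δ)) * P = _
  rw [smul_mul_assoc, one_mul]

/-- The variable `X` of `R[X; δ]`. -/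
def oreX : OrePoly δ := ofPoly δ Polynomial.X

theorem oreX_mul (P : R[X]) : oreX δ * ofPoly δ P = ofPoly δ (leftX δ P) := by
  rw [oreX, ofPoly_mul_ofPoly, ← Polynomial.monomial_one_one_eq_X, oreMul_monomial]; simp

/-- The defining relation of Ore polynomials. -/
theorem oreX_mul_oreC (a : R) : oreX δ * oreC δ a = a • oreX δ + oreC δ (δ a) := by
  change oreX δ * ofPoly δ (a • 1) = a • oreX δ + δ a • ofPoly δ 1
  rw [oreX_mul, leftX_smul, map_add, map_smul, map_smul]
  congr 3
  rw [← Polynomial.monomial_zero_one, leftX_monomial]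
  simp [Polynomial.monomial_one_one_eq_X]

theorem ofPoly_monomial (n : ℕ) (a : R) :
    ofPoly δ (Polynomial.monomial n a) = a • oreX δ ^ n := by
  have key : ofPoly δ (Polynomial.monomial n 1) = oreX δ ^ n := by
    induction n with
    | zero => rfl
    | succ n ih => rw [pow_succ', ← ih, oreX_mul, leftX_monomial]; simp
  rw [← key, ← map_smul, Polynomial.smul_monomial, smul_eq_mul, mul_one]

theorem orePoly_induction {p : OrePoly δ → Prop} (P : OrePoly δ)
    (hadd : ∀ P Q, p P → p Q → p (P + Q)) (hmon : ∀ (n : ℕ) (a : R), p (a • oreX δ ^ n)) : p P := by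
  have : ∀ Q : R[X], p (ofPoly δ Q) := by
    intro Q
    induction Q using Polynomial.induction_on' with
    | add P Q hP hQ => rw [map_add]; exact hadd _ _ hP hQ
    | monomial n a => rw [ofPoly_monomial]; exact hmon n a
  exact this P

variable {δ} in
/-- An Ore polynomial commuting with `X` and with the constants is central. -/
theorem orePoly_central {W : OrePoly δ} (hX : oreX δ * W = W * oreX δ)
    (hC : ∀ a, oreC δ a * W = W * oreC δ a) (P : OrePoly δ) : P * W = W * P := by
  induction P using orePoly_induction with
  | hadd P Q hP hQ => rw [add_mul, mul_add, hP, hQ]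
  | hmon n a =>
    have h : Commute W (oreX δ ^ n) := Commute.pow_right (show W * _ = _ * W from hX.symm) n
    rw [← oreC_mul, mul_assoc, ← h.eq, ← mul_assoc, hC, mul_assoc]

/-- Functoriality of Ore polynomials in the coefficient ring. -/
def oreMap {S : Type*} [CommRing S] {δ : Derivation ℤ R R} {ε : Derivation ℤ S S} (φ : R →+* S)
    (hφ : ∀ a, φ (δ a) = ε (φ a)) : OrePoly δ →+* OrePoly ε where
  toFun P := ofPoly ε (Polynomial.map φ ((ofPoly δ).symm P))
  map_zero' := Polynomial.map_zero φ
  map_one' := Polynomial.map_one φ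
  map_add' P Q := Polynomial.map_add φ
  map_mul' P Q := by
    change Polynomial.map φ (oreMul δ P Q) =
      oreMul ε (Polynomial.map φ (P : R[X])) (Polynomial.map φ (Q : R[X]))
    have h1 : ∀ Q : R[X], Polynomial.map φ (leftX δ Q) = leftX ε (Polynomial.map φ Q) := by
      intro Q
      ext n
      rw [Polynomial.coeff_map, coeff_leftX, coeff_leftX, Polynomial.coeff_map, map_add, hφ,
        ← Polynomial.coeff_map, Polynomial.map_mul, Polynomial.map_X]
    have h2 : ∀ (n : ℕ) (Q : R[X]),
        Polynomial.map φ ((leftX δ ^ n) Q) = (leftX ε ^ n) (Polynomial.map φ Q) := by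
      intro n
      induction n with
      | zero => intro Q; simp
      | succ n ih => intro Q; rw [pow_succ, pow_succ, Module.End.mul_apply, Module.End.mul_apply,
          ih, h1]
    have h3 : ∀ P Q : R[X], Polynomial.map φ (oreMul δ P Q) =
        oreMul ε (Polynomial.map φ P) (Polynomial.map φ Q) := by
      intro P Q
      induction P using Polynomial.induction_on' with
      | add p q hp hq =>
        simp only [oreMul, map_add, LinearMap.add_apply, Polynomial.map_add] at hp hq ⊢
        rw [hp, hq]
      | monomial n a =>
        rw [Polynomial.map_monomial, oreMul_monomial, oreMul_monomial, Polynomial.map_smul, h2]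
    exact h3 P Q

theorem natDegree_leftX_pow (Q : R[X]) (m : ℕ) (hQ : Q.natDegree ≤ m) (i : ℕ) :
    ((leftX δ ^ i) Q).natDegree ≤ i + m ∧ ((leftX δ ^ i) Q).coeff (i + m) = Q.coeff m := by
  induction i with
  | zero => simpa using hQ
  | succ i ih =>
    rw [pow_succ', Module.End.mul_apply]
    set S := (leftX δ ^ i) Q
    constructor
    · rw [Polynomial.natDegree_le_iff_coeff_eq_zero]
      intro k hk
      obtain ⟨k, rfl⟩ : ∃ k', k = k' + 1 := ⟨k - 1, by omega⟩
      rw [coeff_leftX, Polynomial.coeff_X_mul,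
        Polynomial.coeff_eq_zero_of_natDegree_lt (by omega),
        Polynomial.coeff_eq_zero_of_natDegree_lt (by omega), map_zero, add_zero]
    · rw [show i + 1 + m = i + m + 1 by omega, coeff_leftX, Polynomial.coeff_X_mul, ih.2,
        Polynomial.coeff_eq_zero_of_natDegree_lt (n := i + m + 1) (by omega), map_zero, add_zero]

theorem natDegree_oreMul (P Q : R[X]) (n m : ℕ) (hP : P.natDegree ≤ n) (hQ : Q.natDegree ≤ m) :
    (oreMul δ P Q).natDegree ≤ n + m ∧
      (oreMul δ P Q).coeff (n + m) = P.coeff n * Q.coeff m := by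
  have hsum : oreMul δ P Q = ∑ i ∈ Finset.range (n + 1), P.coeff i • (leftX δ ^ i) Q := by
    conv_lhs => rw [P.as_sum_range' (n + 1) (by omega)]
    simp only [oreMul, map_sum, LinearMap.sum_apply, evalEnd_monomial, LinearMap.smul_apply]
  rw [hsum]
  constructor
  · refine Polynomial.natDegree_sum_le_of_forall_le _ _ fun i hi => ?_
    refine (Polynomial.natDegree_smul_le _ _).trans ?_
    have := (natDegree_leftX_pow δ Q m hQ i).1
    have := Finset.mem_range.1 hi
    omega
  · rw [Polynomial.finsetSum_coeff, Finset.sum_range_succ, Finset.sum_eq_zero, zero_add,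
      Polynomial.coeff_smul, (natDegree_leftX_pow δ Q m hQ n).2, smul_eq_mul]
    intro i hi
    rw [Polynomial.coeff_smul, Polynomial.coeff_eq_zero_of_natDegree_lt (p := (leftX δ ^ i) Q), smul_zero]
    have := (natDegree_leftX_pow δ Q m hQ i).1
    have := Finset.mem_range.1 hi
    omega

instance [Nontrivial R] : Nontrivial (OrePoly δ) := inferInstanceAs (Nontrivial R[X])

instance [IsDomain R] : NoZeroDivisors (OrePoly δ) where
  eq_zero_or_eq_zero_of_mul_eq_zero {P Q} h := by
    have key : ∀ P Q : R[X], oreMul δ P Q = 0 → P = 0 ∨ Q = 0 := by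
      intro P Q h
      have := (natDegree_oreMul δ P Q _ _ le_rfl le_rfl).2
      simpa [h] using this
    exact key P Q h

end OrePoly

/-! ### The centre, and the skew field of fractions -/

section Field

variable {K : Type*} [Field K] (δ : Derivation ℤ K K)

/-- The subfield `F` of constants of `(K, δ)`. -/
def constants : Subfield K where
  carrier := {x | δ x = 0}
  mul_mem' {a b} ha hb := by
    rw [Set.mem_ofPred_eq] at ha hb ⊢
    rw [Derivation.leibniz, ha, hb, smul_zero, smul_zero, add_zero]
  one_mem' := δ.map_one_eq_zero
  add_mem' {a b} ha hb := by
    rw [Set.mem_ofPred_eq] at ha hb ⊢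
    rw [map_add, ha, hb, add_zero]
  zero_mem' := map_zero δ
  neg_mem' {a} ha := by
    rw [Set.mem_ofPred_eq] at ha ⊢
    rw [map_neg, ha, neg_zero]
  inv_mem' a ha := by
    rw [Set.mem_ofPred_eq] at ha ⊢
    rw [Derivation.leibniz_inv, ha, smul_zero]

theorem mem_constants {x : K} : x ∈ constants δ ↔ δ x = 0 := Iff.rfl

/-- The derivation `δ` as an `F`-linear endomorphism of `K`. -/
def deltaLin : K →ₗ[constants δ] K where
  toFun := δ
  map_add' := map_add δ
  map_smul' c x := by
    rw [RingHom.id_apply, Subfield.smul_def, smul_eq_mul, Derivation.leibniz,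
      (mem_constants δ).1 c.2, smul_zero, add_zero, Subfield.smul_def]

/-- The polynomial `Z`: the minimal polynomial of `δ`, with coefficients in `F`. -/
def minZ : (constants δ)[X] := minpoly (constants δ) (deltaLin δ : Module.End (constants δ) K)

theorem evalEnd_map (q : (constants δ)[X]) (x : K) :
    evalEnd (δ.toLinearMap : Module.End ℤ K) (q.map (algebraMap (constants δ) K)) x =
      Polynomial.aeval (deltaLin δ : Module.End (constants δ) K) q x := by
  have hpow : ∀ (n : ℕ) (y : K), ((δ.toLinearMap : Module.End ℤ K) ^ n) y =
      ((deltaLin δ : Module.End (constants δ) K) ^ n) y := by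
    intro n
    induction n with
    | zero => intro y; rfl
    | succ n ih =>
      intro y
      rw [pow_succ, pow_succ, Module.End.mul_apply, Module.End.mul_apply, ih]
      rfl
  induction q using Polynomial.induction_on' with
  | add p q hp hq => simp only [Polynomial.map_add, map_add, LinearMap.add_apply, hp, hq]
  | monomial n a =>
    rw [Polynomial.map_monomial, evalEnd_monomial, Polynomial.aeval_monomial,
      LinearMap.smul_apply, hpow, ← Algebra.smul_def]
    rfl

theorem oreX_mul_oreC_const (c : constants δ) :
    oreX δ * oreC δ (c : K) = oreC δ (c : K) * oreX δ := by
  rw [oreX_mul_oreC, (mem_constants δ).1 c.2, map_zero, add_zero, oreC_mul]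

/-- A nonzero polynomial over `K` that annihilates `δ` has degree at least that of `Z`. -/
theorem minZ_minimal (P : K[X]) (hP : evalEnd (δ.toLinearMap : Module.End ℤ K) P = 0)
    (hdeg : P.degree < (minZ δ).degree) : P = 0 := by
  by_contra hP0
  induction hn : P.natDegree using Nat.strong_induction_on generalizing P with
  | _ n ih =>
    -- reduce to a monic polynomial
    wlog hm : P.Monic generalizing P
    · refine this (P.leadingCoeff⁻¹ • P) ?_ ?_ ?_ ?_ ?_
      · rw [map_smul, hP, smul_zero]
      · exact (Polynomial.degree_smul_le _ _).trans_lt hdeg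
      · exact smul_ne_zero (inv_ne_zero (Polynomial.leadingCoeff_ne_zero.2 hP0)) hP0
      · rw [Polynomial.natDegree_smul _ (inv_ne_zero (Polynomial.leadingCoeff_ne_zero.2 hP0)), hn]
      · rw [Polynomial.smul_eq_C_mul, mul_comm]
        exact Polynomial.monic_mul_leadingCoeff_inv hP0
    set P' : K[X] := leftX δ P - Polynomial.X * P with hP'
    have hco : ∀ k, P'.coeff k = δ (P.coeff k) := fun k => by
      rw [hP', Polynomial.coeff_sub, coeff_leftX, add_sub_cancel_left]
    have hu : ∀ (a : K) (x : K), (δ.toLinearMap : Module.End ℤ K) (a • x) =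
        a • (δ.toLinearMap : Module.End ℤ K) x + δ a • x := by
      intro a x
      change δ (a • x) = a • δ x + δ a • x
      simp only [smul_eq_mul, Derivation.leibniz]
      ring
    have hXP : evalEnd (δ.toLinearMap : Module.End ℤ K) (Polynomial.X * P) = 0 := by
      have : ∀ Q : K[X], evalEnd (δ.toLinearMap : Module.End ℤ K) (Polynomial.X * Q) =
          evalEnd (δ.toLinearMap : Module.End ℤ K) Q * δ.toLinearMap := by
        intro Q
        induction Q using Polynomial.induction_on' with
        | add p q hp hq => rw [mul_add, map_add, hp, hq, map_add, add_mul]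
        | monomial m a =>
          rw [Polynomial.X_mul_monomial, evalEnd_monomial, evalEnd_monomial, pow_succ,
            smul_mul_assoc]
      rw [this, hP, zero_mul]
    have hev : evalEnd (δ.toLinearMap : Module.End ℤ K) P' = 0 := by
      rw [hP', map_sub, hXP, sub_zero, evalEnd_leftX hu, hP, mul_zero]
    have hdegP' : P'.degree < P.degree := by
      rw [Polynomial.degree_eq_natDegree hP0, Polynomial.degree_lt_iff_coeff_zero]
      intro k hk
      rw [hco]
      rcases hk.eq_or_lt with rfl | hk
      · rw [hm.coeff_natDegree, δ.map_one_eq_zero]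
      · rw [Polynomial.coeff_eq_zero_of_natDegree_lt hk, map_zero]
    have hP'0 : P' = 0 := by
      by_contra h0
      refine ih P'.natDegree ?_ P' hev (hdegP'.trans hdeg) h0 rfl
      rw [← hn]
      exact Polynomial.natDegree_lt_natDegree h0 hdegP'
    have hlift : P ∈ Polynomial.lifts (algebraMap (constants δ) K) := by
      rw [Polynomial.lifts_iff_coeff_lifts]
      intro k
      refine ⟨⟨P.coeff k, ?_⟩, rfl⟩
      rw [mem_constants, ← hco, hP'0, Polynomial.coeff_zero]
    obtain ⟨q, hq⟩ := (Polynomial.mem_lifts _).1 hlift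
    have hq0 : Polynomial.aeval (deltaLin δ : Module.End (constants δ) K) q = 0 := by
      ext x
      rw [← evalEnd_map, hq, hP]; rfl
    have hqne : q ≠ 0 := by
      rintro rfl
      exact hP0 (by rw [← hq, Polynomial.map_zero])
    have h1 := minpoly.degree_le_of_ne_zero (constants δ) _ hqne hq0
    rw [← hq, Polynomial.degree_map] at hdeg
    exact absurd hdeg (not_lt.2 h1)

/-- The central Ore polynomial `Z(X)`. -/
def oreZ : OrePoly δ :=
  ofPoly δ ((minZ δ).map (algebraMap (constants δ) K))

theorem oreX_mul_oreZ : oreX δ * oreZ δ = oreZ δ * oreX δ := by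
  have h : ∀ q : (constants δ)[X], oreX δ * ofPoly δ (q.map (algebraMap (constants δ) K)) =
      ofPoly δ (q.map (algebraMap (constants δ) K)) * oreX δ := by
    intro q
    induction q using Polynomial.induction_on' with
    | add p q hp hq => rw [Polynomial.map_add, map_add, mul_add, add_mul, hp, hq]
    | monomial n a =>
      rw [Polynomial.map_monomial, ofPoly_monomial, ← oreC_mul, ← mul_assoc,
        show algebraMap (constants δ) K a = (a : K) from rfl, oreX_mul_oreC_const, mul_assoc,
        mul_assoc, ← pow_succ, ← pow_succ']
  exact h _

variable [FiniteDimensional (constants δ) K]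

theorem minZ_monic : (minZ δ).Monic := minpoly.monic (Algebra.IsIntegral.isIntegral _)

theorem oreC_mul_oreZ (a : K) : oreC δ a * oreZ δ = oreZ δ * oreC δ a := by
  set s := (minZ δ).natDegree
  set Zp : K[X] := (minZ δ).map (algebraMap (constants δ) K)
  have hZdeg : Zp.natDegree ≤ s := Polynomial.natDegree_map_le
  have hu : ∀ (a : K) (x : K), (δ.toLinearMap : Module.End ℤ K) (a • x) =
      a • (δ.toLinearMap : Module.End ℤ K) x + δ a • x := by
    intro a x
    change δ (a • x) = a • δ x + δ a • x
    simp only [smul_eq_mul, Derivation.leibniz]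
    ring
  have hZ : evalEnd (δ.toLinearMap : Module.End ℤ K) Zp = 0 := by
    ext x
    rw [evalEnd_map, minZ, minpoly.aeval]; rfl
  have h := minZ_minimal δ (oreMul δ (Polynomial.C a) Zp - oreMul δ Zp (Polynomial.C a)) ?_ ?_
  · have ha : oreC δ a = ofPoly δ (Polynomial.C a) := by
      change ofPoly δ (a • 1) = _
      rw [Polynomial.smul_eq_C_mul, mul_one]
    rw [ha]
    exact sub_eq_zero.1 h
  · rw [map_sub, evalEnd_oreMul hu, evalEnd_oreMul hu, hZ, mul_zero, zero_mul, sub_zero]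
  · rw [Polynomial.degree_eq_natDegree (minZ_monic δ).ne_zero, Polynomial.degree_lt_iff_coeff_zero]
    intro k hk
    have h1 := natDegree_oreMul δ (Polynomial.C a) Zp 0 s (by simp) hZdeg
    have h2 := natDegree_oreMul δ Zp (Polynomial.C a) s 0 hZdeg (by simp)
    rw [zero_add] at h1
    rw [add_zero] at h2
    rw [Polynomial.coeff_sub]
    change s ≤ k at hk
    rcases hk.eq_or_lt with rfl | hk
    · rw [h1.2, h2.2, Polynomial.coeff_C_zero, mul_comm, sub_self]
    · rw [Polynomial.coeff_eq_zero_of_natDegree_lt (h1.1.trans_lt hk),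
        Polynomial.coeff_eq_zero_of_natDegree_lt (h2.1.trans_lt hk), sub_self]

theorem oreZ_central (P : OrePoly δ) : P * oreZ δ = oreZ δ * P :=
  orePoly_central (oreX_mul_oreZ δ) (oreC_mul_oreZ δ) P

/-- The identification of `K[Y]` with the commutative subring `C⁺ = K[Z(X)]`, by `Y ↦ Z(X)`. -/
def cHom : K[X] →+* OrePoly δ :=
  Polynomial.eval₂RingHom' (oreC δ) (oreZ δ) (oreC_mul_oreZ δ)

/-- The identification of `F[Y]` with the centre `Z⁺ = F[Z(X)]`, by `Y ↦ Z(X)`. -/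
def zHom : (constants δ)[X] →+* OrePoly δ :=
  (cHom δ).comp (Polynomial.mapRingHom (algebraMap (constants δ) K))

theorem cHom_C (a : K) : cHom δ (Polynomial.C a) = oreC δ a := Polynomial.eval₂_C _ _

theorem cHom_X : cHom δ Polynomial.X = oreZ δ := Polynomial.eval₂_X _ _

theorem zHom_C (a : constants δ) : zHom δ (Polynomial.C a) = oreC δ (a : K) := by
  rw [zHom, RingHom.comp_apply, Polynomial.coe_mapRingHom, Polynomial.map_C, cHom_C]; rfl

theorem zHom_X : zHom δ Polynomial.X = oreZ δ := by
  rw [zHom, RingHom.comp_apply, Polynomial.coe_mapRingHom, Polynomial.map_X, cHom_X]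

theorem zHom_central (D : (constants δ)[X]) (P : OrePoly δ) : P * zHom δ D = zHom δ D * P := by
  induction D using Polynomial.induction_on with
  | C a =>
    rw [zHom_C]
    refine orePoly_central (oreX_mul_oreC_const δ a) (fun b => ?_) P
    rw [← map_mul, ← map_mul, mul_comm]
  | add p q hp hq => rw [map_add, mul_add, add_mul, hp, hq]
  | monomial n a h =>
    rw [pow_succ, ← mul_assoc, map_mul, zHom_X, ← mul_assoc, h, mul_assoc, oreZ_central, mul_assoc]

theorem cHom_coeff (p : K[X]) (n : ℕ) (hn : p.natDegree ≤ n) :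
    ((ofPoly δ).symm (cHom δ p)).natDegree ≤ n * (minZ δ).natDegree ∧
      ((ofPoly δ).symm (cHom δ p)).coeff (n * (minZ δ).natDegree) = p.coeff n := by
  by_cases hs : (minZ δ).natDegree = 0
  · exfalso
    have h1 : minZ δ = 1 := (minZ_monic δ).natDegree_eq_zero.1 hs
    have h2 : Polynomial.aeval (deltaLin δ : Module.End (constants δ) K) (minZ δ) = 0 :=
      minpoly.aeval _ _
    rw [h1, map_one] at h2
    exact one_ne_zero h2
  set s := (minZ δ).natDegree
  set Zp : K[X] := (minZ δ).map (algebraMap (constants δ) K)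
  have hZdeg : Zp.natDegree ≤ s := Polynomial.natDegree_map_le
  have hZc : Zp.coeff s = 1 := by
    rw [Polynomial.coeff_map, (minZ_monic δ).coeff_natDegree, map_one]
  have hpow : ∀ n : ℕ, ((ofPoly δ).symm (oreZ δ ^ n)).natDegree ≤ n * s ∧
      ((ofPoly δ).symm (oreZ δ ^ n)).coeff (n * s) = 1 := by
    intro n
    induction n with
    | zero => exact ⟨by rw [pow_zero]; exact (Polynomial.natDegree_one).le.trans (Nat.zero_le _),
        by rw [pow_zero, zero_mul]; exact Polynomial.coeff_one_zero⟩
    | succ n ih =>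
      have := natDegree_oreMul δ ((ofPoly δ).symm (oreZ δ ^ n)) Zp (n * s) s ih.1 hZdeg
      rw [ih.2, hZc, one_mul, ← Nat.succ_mul] at this
      rw [pow_succ]
      exact this
  have hsum : (ofPoly δ).symm (cHom δ p) =
      ∑ i ∈ Finset.range (n + 1), p.coeff i • (ofPoly δ).symm (oreZ δ ^ i) := by
    have : cHom δ p = ∑ i ∈ Finset.range (n + 1), p.coeff i • oreZ δ ^ i := by
      simp only [← oreC_mul]
      exact Polynomial.eval₂_eq_sum_range' (oreC δ) (by omega) (oreZ δ)
    rw [this, map_sum]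
    simp only [map_smul]
  rw [hsum]
  constructor
  · refine Polynomial.natDegree_sum_le_of_forall_le _ _ fun i hi => ?_
    refine (Polynomial.natDegree_smul_le _ _).trans ((hpow i).1.trans ?_)
    exact Nat.mul_le_mul_right s (by have := Finset.mem_range.1 hi; omega)
  · rw [Polynomial.finsetSum_coeff, Finset.sum_range_succ, Finset.sum_eq_zero, zero_add,
      Polynomial.coeff_smul, (hpow n).2, smul_eq_mul, mul_one]
    intro i hi
    rw [Polynomial.coeff_smul,
      Polynomial.coeff_eq_zero_of_natDegree_lt (p := (ofPoly δ).symm (oreZ δ ^ i)), smul_zero]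
    refine (hpow i).1.trans_lt ?_
    exact Nat.mul_lt_mul_of_pos_right (Finset.mem_range.1 hi) (Nat.pos_of_ne_zero hs)

theorem zHom_ne_zero {D : (constants δ)[X]} (hD : D ≠ 0) : zHom δ D ≠ 0 := by
  intro h
  have h1 := (cHom_coeff δ (D.map (algebraMap (constants δ) K)) _ le_rfl).2
  rw [show cHom δ (D.map (algebraMap (constants δ) K)) = zHom δ D from rfl, h, map_zero,
    Polynomial.coeff_zero, Polynomial.coeff_natDegree] at h1
  rw [eq_comm, Polynomial.leadingCoeff_eq_zero, Polynomial.map_eq_zero] at h1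
  exact hD h1

theorem zHom_smul_monomial_mem {M : AddSubgroup (OrePoly δ)}
    (hM : ∀ (D : (constants δ)[X]) (P : OrePoly δ), P ∈ M → zHom δ D * P ∈ M)
    (h0 : ∀ (a : K) (i : ℕ), i < (minZ δ).natDegree → a • oreX δ ^ i ∈ M) (n : ℕ) (a : K) :
    a • oreX δ ^ n ∈ M := by
  induction n using Nat.strong_induction_on generalizing a with
  | _ n ih =>
    by_cases hn : n < (minZ δ).natDegree
    · exact h0 a n hn
    set s := (minZ δ).natDegree
    obtain ⟨m, rfl⟩ : ∃ m, n = s + m := ⟨n - s, by omega⟩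
    by_cases hs : s = 0
    · exfalso
      have h1 : minZ δ = 1 := (minZ_monic δ).natDegree_eq_zero.1 hs
      have h2 : Polynomial.aeval (deltaLin δ : Module.End (constants δ) K) (minZ δ) = 0 :=
        minpoly.aeval _ _
      rw [h1, map_one] at h2
      exact one_ne_zero h2
    have hZ : oreZ δ = oreX δ ^ s + ∑ i ∈ Finset.range s, ((minZ δ).coeff i : K) • oreX δ ^ i := by
      have h1 : (minZ δ).map (algebraMap (constants δ) K) =
          ∑ i ∈ Finset.range (s + 1), Polynomial.monomial i ((minZ δ).coeff i : K) := by
        have := Polynomial.as_sum_range' ((minZ δ).map (algebraMap (constants δ) K)) (s + 1)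
          (Nat.lt_succ_of_le Polynomial.natDegree_map_le)
        simp only [Polynomial.coeff_map] at this
        exact this
      rw [oreZ, h1, map_sum, Finset.sum_range_succ, add_comm]
      simp only [ofPoly_monomial]
      rw [(minZ_monic δ).coeff_natDegree]
      simp
    have key : a • oreX δ ^ (s + m) = zHom δ Polynomial.X * (a • oreX δ ^ m) -
        ∑ i ∈ Finset.range s, (a * ((minZ δ).coeff i : K)) • oreX δ ^ (i + m) := by
      rw [zHom_X, ← oreZ_central, smul_mul_assoc, oreZ_central, hZ, add_mul, Finset.sum_mul,
        smul_add, Finset.smul_sum, ← pow_add]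
      simp only [smul_mul_assoc, ← pow_add, mul_smul]
      rw [add_sub_cancel_right]
    rw [key]
    refine M.sub_mem (hM _ _ (ih m (by omega) a)) (M.sum_mem fun i hi => ih _ ?_ _)
    have := Finset.mem_range.1 hi
    omega

/-- Every nonzero Ore polynomial has a nonzero multiple in the centre. -/
theorem exists_central_multiple {P : OrePoly δ} (hP : P ≠ 0) :
    ∃ D : (constants δ)[X], D ≠ 0 ∧ ∃ Q : OrePoly δ, P * Q = zHom δ D ∧ Q * P = zHom δ D := by
  let _ : Algebra (constants δ)[X] (OrePoly δ) :=
    (zHom δ).toAlgebra' fun D P => (zHom_central δ D P).symm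
  have hsm : ∀ (D : (constants δ)[X]) (P : OrePoly δ), D • P = zHom δ D * P := fun _ _ => rfl
  have hfin : Module.Finite (constants δ)[X] (OrePoly δ) := by
    let b := Module.finBasis (constants δ) K
    let v : Fin (Module.finrank (constants δ) K) × Fin (minZ δ).natDegree → OrePoly δ :=
      fun ji => b ji.1 • oreX δ ^ (ji.2 : ℕ)
    refine ⟨⟨(Set.finite_range v).toFinset, ?_⟩⟩
    rw [Set.Finite.coe_toFinset, eq_top_iff]
    intro P _
    induction P using orePoly_induction with
    | hadd P Q hP hQ => exact Submodule.add_mem _ (hP trivial) (hQ trivial)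
    | hmon n a =>
      refine zHom_smul_monomial_mem δ
        (M := (Submodule.span (constants δ)[X] (Set.range v)).toAddSubgroup) ?_ ?_ n a
      · intro D P hP
        exact Submodule.smul_mem _ D hP
      · intro a i hi
        rw [← b.sum_repr a, Finset.sum_smul]
        refine Submodule.sum_mem _ fun j _ => ?_
        have : (b.repr a j • b j) • oreX δ ^ i = Polynomial.C (b.repr a j) • v (j, ⟨i, hi⟩) := by
          rw [hsm, zHom_C, oreC_mul, Subfield.smul_def, smul_eq_mul, mul_smul]
        rw [this]
        exact Submodule.smul_mem _ _ (Submodule.subset_span ⟨_, rfl⟩)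
  obtain ⟨D, hD, Q, hQ⟩ := IsAlgebraic.exists_nonzero_dvd
    (IsIntegral.of_finite (constants δ)[X] P).isAlgebraic (mem_nonZeroDivisors_of_ne_zero hP)
  refine ⟨D, hD, Q, hQ.symm, ?_⟩
  have hQ' : zHom δ D = P * Q := hQ
  refine mul_left_cancel₀ hP ?_
  rw [← mul_assoc, ← hQ', zHom_central]

theorem ore_condition (P : OrePoly δ) (S : (OrePoly δ)⁰) :
    ∃ QT : OrePoly δ × (OrePoly δ)⁰, (QT.2 : OrePoly δ) * P = QT.1 * S := by
  obtain ⟨D, hD, Q, -, hQ⟩ := exists_central_multiple δ (nonZeroDivisors.coe_ne_zero S)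
  refine ⟨(P * Q, ⟨zHom δ D, mem_nonZeroDivisors_of_ne_zero (zHom_ne_zero δ hD)⟩), ?_⟩
  simp only
  rw [mul_assoc, hQ, zHom_central]

instance : OreLocalization.OreSet (OrePoly δ)⁰ where
  ore_right_cancel r₁ r₂ s h :=
    ⟨1, by rw [mul_right_cancel₀ (nonZeroDivisors.coe_ne_zero s) h]⟩
  oreNum r s := (ore_condition δ r s).choose.1
  oreDenom r s := (ore_condition δ r s).choose.2
  ore_eq r s := (ore_condition δ r s).choose_spec

/-- The skew field of fractions `𝒜` of `K[X; δ]`. -/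
abbrev OreFrac : Type _ := OreLocalization (OrePoly δ)⁰ (OrePoly δ)

/-- The inclusion of `K[X; δ]` in its skew field of fractions. -/
def toFrac : OrePoly δ →+* OreFrac δ := OreLocalization.numeratorRingHom

/-- Every element of `𝒜` is of the form `D⁻¹ P` with `D` a nonzero element of the centre. -/
theorem exists_central_denominator (f : OreFrac δ) :
    ∃ DP : (constants δ)[X] × OrePoly δ, DP.1 ≠ 0 ∧
      toFrac δ (zHom δ DP.1) * f = toFrac δ DP.2 := by
  induction f using OreLocalization.ind with
  | c r s =>
    obtain ⟨D, hD, Q, -, hQ⟩ := exists_central_multiple δ (nonZeroDivisors.coe_ne_zero s)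
    refine ⟨(D, Q * r), hD, ?_⟩
    simp only
    rw [← hQ, map_mul, map_mul, mul_assoc]
    congr 1
    exact OreLocalization.mul_cancel

end Field

/-! ### Reduced traces -/

section Trace

variable {K : Type*} [Field K] (δ : Derivation ℤ K K) [FiniteDimensional (constants δ) K]

/-- The left `C⁺`-module structure of `K[X; δ]`, with `C⁺ = K[Z(X)]` identified with `K[Y]`. -/
instance cModule : Module K[X] (OrePoly δ) := Module.compHom (OrePoly δ) (cHom δ)

theorem cModule_smul (p : K[X]) (P : OrePoly δ) : p • P = cHom δ p * P := rfl

/-- Right multiplication `x ↦ x f`, as a `C⁺`-linear endomorphism of `K[X; δ]`. -/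
def rightMul (f : OrePoly δ) : OrePoly δ →ₗ[K[X]] OrePoly δ where
  toFun x := x * f
  map_add' x y := add_mul x y f
  map_smul' p x := mul_assoc (cHom δ p) x f

/-- The reduced trace `K[X; δ] → C⁺`, with `C⁺ = K[Z(X)]` identified with `K[Y]`. -/
def reducedTrace (f : OrePoly δ) : K[X] := LinearMap.trace K[X] (OrePoly δ) (rightMul δ f)

theorem reducedTrace_zHom_mul (D : (constants δ)[X]) (f : OrePoly δ) :
    reducedTrace δ (zHom δ D * f) = D.map (algebraMap (constants δ) K) * reducedTrace δ f := by
  have : rightMul δ (zHom δ D * f) = D.map (algebraMap (constants δ) K) • rightMul δ f := by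
    ext x
    change x * (zHom δ D * f) = zHom δ D * (x * f)
    rw [← mul_assoc, zHom_central, mul_assoc]
  rw [reducedTrace, this, map_smul, smul_eq_mul, reducedTrace]

/-- The extension of the reduced trace to the skew field of fractions, `Trd (D⁻¹ P) = D⁻¹ Trd P` for
`D` a nonzero element of the centre; it takes values in `Frac C⁺`, identified with `K(Y)`. -/
def reducedTraceFrac (f : OreFrac δ) : RatFunc K :=
  algebraMap K[X] (RatFunc K) (reducedTrace δ (exists_central_denominator δ f).choose.2) /
    algebraMap K[X] (RatFunc K)
      ((exists_central_denominator δ f).choose.1.map (algebraMap (constants δ) K))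

/-- The extended reduced trace does not depend on the fraction that represents an element. -/
theorem reducedTraceFrac_eq {f : OreFrac δ} {D : (constants δ)[X]} {P : OrePoly δ} (hD : D ≠ 0)
    (h : toFrac δ (zHom δ D) * f = toFrac δ P) :
    reducedTraceFrac δ f = algebraMap K[X] (RatFunc K) (reducedTrace δ P) /
      algebraMap K[X] (RatFunc K) (D.map (algebraMap (constants δ) K)) := by
  obtain ⟨hE, h'⟩ := (exists_central_denominator δ f).choose_spec
  rw [reducedTraceFrac]
  set E := (exists_central_denominator δ f).choose.1
  set Q := (exists_central_denominator δ f).choose.2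
  have hne : ∀ {D : (constants δ)[X]}, D ≠ 0 →
      algebraMap K[X] (RatFunc K) (D.map (algebraMap (constants δ) K)) ≠ 0 := fun hD =>
    RatFunc.algebraMap_ne_zero (by rwa [Ne, Polynomial.map_eq_zero])
  have key : zHom δ D * Q = zHom δ E * P := by
    have hinj : Function.Injective (toFrac δ) :=
      OreLocalization.numeratorHom_inj (S := (OrePoly δ)⁰) inf_le_left
    apply hinj
    rw [map_mul, map_mul, ← h, ← h', ← mul_assoc, ← mul_assoc,
      ← map_mul (toFrac δ), ← map_mul (toFrac δ), zHom_central]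
  rw [div_eq_div_iff (hne hE) (hne hD), ← map_mul, ← map_mul, mul_comm, ← reducedTrace_zHom_mul,
    key, reducedTrace_zHom_mul, mul_comm]

/-- The inclusion of `𝒵 = Frac Z⁺` in `𝒞 = Frac C⁺`, i.e. of `F(Y)` in `K(Y)`. -/
def zToC : RatFunc (constants δ) →+* RatFunc K :=
  IsFractionRing.map (K := RatFunc (constants δ)) (L := RatFunc K)
    (j := Polynomial.mapRingHom (algebraMap (constants δ) K))
    (Polynomial.map_injective _ (algebraMap (constants δ) K).injective)

end Trace

/-! ### Separable base change -/

section BaseChange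

variable {K : Type*} [Field K] (δ : Derivation ℤ K K)
variable (Fs : Type*) [Field Fs] [Algebra (constants δ) Fs]

/-- The ring `Kˢ = Fˢ ⊗ K`. -/
def ScalarExt : Type _ := Fs ⊗[constants δ] K

instance : CommRing (ScalarExt δ Fs) := inferInstanceAs (CommRing (Fs ⊗[constants δ] K))

/-- The structure of `Fˢ`-algebra on `Kˢ = Fˢ ⊗ K`, by `c ↦ c ⊗ 1`. -/
instance : Algebra Fs (ScalarExt δ Fs) := inferInstanceAs (Algebra Fs (Fs ⊗[constants δ] K))

/-- The inclusion `K → Kˢ = Fˢ ⊗ K`, `a ↦ 1 ⊗ a`. -/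
def scalarK : K →+* ScalarExt δ Fs :=
  (Algebra.TensorProduct.includeRight : K →ₐ[constants δ] Fs ⊗[constants δ] K).toRingHom

theorem tmul_eq (c : Fs) (a : K) :
    (c ⊗ₜ[constants δ] a : Fs ⊗[constants δ] K) =
      (algebraMap Fs (ScalarExt δ Fs) c * scalarK δ Fs a : ScalarExt δ Fs) := by
  change _ = (c ⊗ₜ[constants δ] (1 : K)) * ((1 : Fs) ⊗ₜ[constants δ] a)
  rw [Algebra.TensorProduct.tmul_mul_tmul, mul_one, one_mul]

theorem scalarExt_induction {p : ScalarExt δ Fs → Prop} (x : ScalarExt δ Fs) (zero : p 0)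
    (add : ∀ x y, p x → p y → p (x + y))
    (mul : ∀ (c : Fs) (a : K), p (algebraMap Fs (ScalarExt δ Fs) c * scalarK δ Fs a)) : p x :=
  TensorProduct.induction_on (motive := p) x zero
    (fun c a => by rw [tmul_eq]; exact mul c a) add

theorem scalarK_const (a : constants δ) :
    scalarK δ Fs (a : K) = algebraMap Fs (ScalarExt δ Fs) (algebraMap (constants δ) Fs a) := by
  change (1 : Fs) ⊗ₜ[constants δ] (a : K) = (algebraMap (constants δ) Fs a) ⊗ₜ[constants δ] (1 : K)
  rw [Algebra.algebraMap_eq_smul_one, TensorProduct.smul_tmul]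
  congr 1
  rw [Subfield.smul_def, smul_eq_mul, mul_one]

/-- The `Fˢ`-linear extension of `δ` to `Kˢ = Fˢ ⊗ K`, as an additive map. -/
def extDelta : ScalarExt δ Fs →+ ScalarExt δ Fs :=
  ((deltaLin δ).lTensor Fs : Fs ⊗[constants δ] K →ₗ[constants δ] Fs ⊗[constants δ] K).toAddMonoidHom

theorem extDelta_mul (c : Fs) (a : K) :
    extDelta δ Fs (algebraMap Fs (ScalarExt δ Fs) c * scalarK δ Fs a) =
      algebraMap Fs (ScalarExt δ Fs) c * scalarK δ Fs (δ a) := by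
  rw [← tmul_eq, ← tmul_eq]; rfl

/-- The `Fˢ`-linear extension of `δ` to a derivation of `Kˢ = Fˢ ⊗ K`. -/
def extDeriv : Derivation ℤ (ScalarExt δ Fs) (ScalarExt δ Fs) :=
  Derivation.mk' (extDelta δ Fs).toIntLinearMap (by
    intro x y
    change extDelta δ Fs (x * y) = x * extDelta δ Fs y + y * extDelta δ Fs x
    induction x using scalarExt_induction with
    | zero => simp
    | add x x' hx hx' => rw [add_mul, map_add, hx, hx', map_add]; ring
    | mul a b =>
      induction y using scalarExt_induction with
      | zero => simp
      | add y y' hy hy' => rw [mul_add, map_add, hy, hy', map_add]; ring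
      | mul c d =>
        rw [mul_mul_mul_comm, ← map_mul, ← map_mul, extDelta_mul, extDelta_mul, extDelta_mul,
          Derivation.leibniz, smul_eq_mul, smul_eq_mul, map_add, map_mul, map_mul, map_mul]
        ring)

theorem extDeriv_mul (c : Fs) (a : K) :
    extDeriv δ Fs (algebraMap Fs (ScalarExt δ Fs) c * scalarK δ Fs a) =
      algebraMap Fs (ScalarExt δ Fs) c * scalarK δ Fs (δ a) := extDelta_mul δ Fs c a

theorem extDeriv_algebraMap (c : Fs) : extDeriv δ Fs (algebraMap Fs (ScalarExt δ Fs) c) = 0 := by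
  have := extDeriv_mul δ Fs c 1
  rwa [map_one, mul_one, δ.map_one_eq_zero, map_zero, mul_zero] at this

theorem extDeriv_scalarK (a : K) :
    extDeriv δ Fs (scalarK δ Fs a) = scalarK δ Fs (δ a) := by
  have := extDeriv_mul δ Fs 1 a
  rwa [map_one, one_mul, one_mul] at this

/-- The Ore polynomials over `Kˢ`. -/
abbrev ExtOre : Type _ := OrePoly (extDeriv δ Fs)

/-- The inclusion of `K[X; δ]` in `Kˢ[X; δ]`. -/
def toExt : OrePoly δ →+* ExtOre δ Fs :=
  oreMap (scalarK δ Fs) fun a => (extDeriv_scalarK δ Fs a).symm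

variable {Fs} in
/-- The central element `N = Z(X) - z` of `Kˢ[X; δ]`, for `z ∈ Fˢ`. -/
def oreN (z : Fs) : ExtOre δ Fs :=
  toExt δ Fs (oreZ δ) - oreC (extDeriv δ Fs) (algebraMap Fs (ScalarExt δ Fs) z)

theorem toExt_oreC (a : K) : toExt δ Fs (oreC δ a) = oreC (extDeriv δ Fs) (scalarK δ Fs a) := by
  change Polynomial.map _ (a • (1 : K[X])) = (scalarK δ Fs a) • (1 : (ScalarExt δ Fs)[X])
  rw [Polynomial.map_smul, Polynomial.map_one]

theorem toExt_oreX : toExt δ Fs (oreX δ) = oreX (extDeriv δ Fs) := Polynomial.map_X _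

theorem oreX_mul_oreC_ext (c : Fs) :
    oreX (extDeriv δ Fs) * oreC (extDeriv δ Fs) (algebraMap Fs (ScalarExt δ Fs) c) =
      oreC (extDeriv δ Fs) (algebraMap Fs (ScalarExt δ Fs) c) * oreX (extDeriv δ Fs) := by
  rw [oreX_mul_oreC, extDeriv_algebraMap, map_zero, add_zero,
    oreC_mul]

theorem oreC_ext_central (c : Fs) (P : ExtOre δ Fs) :
    P * oreC (extDeriv δ Fs) (algebraMap Fs (ScalarExt δ Fs) c) = oreC (extDeriv δ Fs) (algebraMap Fs (ScalarExt δ Fs) c) * P :=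
  orePoly_central (oreX_mul_oreC_ext δ Fs c) (fun a => by rw [← map_mul, ← map_mul, mul_comm]) P

variable [FiniteDimensional (constants δ) K]

theorem toExt_oreZ_central (P : ExtOre δ Fs) :
    P * toExt δ Fs (oreZ δ) = toExt δ Fs (oreZ δ) * P := by
  refine orePoly_central ?_ (fun a => ?_) P
  · rw [← toExt_oreX, ← map_mul, ← map_mul, oreX_mul_oreZ]
  · induction a using scalarExt_induction with
    | zero => simp
    | add a b ha hb => rw [map_add, add_mul, mul_add, ha, hb]
    | mul a b =>
      rw [map_mul, mul_assoc, ← toExt_oreC, ← map_mul, oreC_mul_oreZ, map_mul, ← mul_assoc,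
        ← oreC_ext_central, mul_assoc]

variable {Fs}

theorem oreN_central (z : Fs) (P : ExtOre δ Fs) : P * oreN δ z = oreN δ z * P := by
  rw [oreN, mul_sub, sub_mul, toExt_oreZ_central, oreC_ext_central]

end BaseChange

/-! ### Taylor expansions and skew residues -/

section Taylor

variable {K : Type*} [Field K] (δ : Derivation ℤ K K) [FiniteDimensional (constants δ) K]
variable {Fs : Type*} [Field Fs] [Algebra (constants δ) Fs] (z : Fs)

/-- The two-sided ideal of `Kˢ[X; δ]` generated by `N = Z(X) - z`. -/
def idealN : Ideal (ExtOre δ Fs) := Ideal.span {oreN δ z}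

instance : (idealN δ z).IsTwoSided := ⟨fun b h => by
  obtain ⟨c, rfl⟩ := Ideal.mem_span_singleton'.1 h
  rw [mul_assoc, ← oreN_central, ← mul_assoc]
  exact Ideal.mem_span_singleton'.2 ⟨_, rfl⟩⟩

/-- The quotient ring `Kˢ[X; δ] / (N)`. -/
abbrev ResRing : Type _ := ExtOre δ Fs ⧸ idealN δ z

/-- The completion `lim Kˢ[X; δ] / (Nᵐ)`, as the ring of compatible families. -/
def completion : Subring (∀ m : ℕ, ExtOre δ Fs ⧸ idealN δ z ^ m) where
  carrier := {x | ∀ m : ℕ, Ideal.Quotient.factorPow (idealN δ z) m.le_succ (x (m + 1)) = x m}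
  mul_mem' hx hy m := by rw [Pi.mul_apply, Pi.mul_apply, map_mul, hx, hy]
  one_mem' m := map_one _
  add_mem' hx hy m := by rw [Pi.add_apply, Pi.add_apply, map_add, hx, hy]
  zero_mem' m := map_zero _
  neg_mem' hx m := by rw [Pi.neg_apply, Pi.neg_apply, map_neg, hx]

/-- The canonical map from `Kˢ[X; δ]` to its completion. -/
def toCompletion : ExtOre δ Fs →+* completion δ z where
  toFun P := ⟨fun _ => Ideal.Quotient.mk _ P, fun _ => rfl⟩
  map_one' := rfl
  map_mul' _ _ := rfl
  map_zero' := rfl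
  map_add' _ _ := rfl

/-- `z`-admissible isomorphisms: isomorphisms of `Kˢ`-algebras from the completion to the ring of
power series over `Kˢ[X; δ] / (N)`, mapping `N` to `T` and inducing the identity modulo `N` on the
left and modulo `T` on the right. -/
structure AdmissibleIso extends completion δ z ≃+* PowerSeries (ResRing δ z) where
  map_scalar : ∀ a : ScalarExt δ Fs, toRingEquiv (toCompletion δ z (oreC (extDeriv δ Fs) a)) =
    PowerSeries.C (Ideal.Quotient.mk (idealN δ z) (oreC (extDeriv δ Fs) a))
  map_N : toRingEquiv (toCompletion δ z (oreN δ z)) = PowerSeries.X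
  residual : ∀ (x : completion δ z) (P : ExtOre δ Fs),
    (x : ∀ m : ℕ, ExtOre δ Fs ⧸ idealN δ z ^ m) 1 = Ideal.Quotient.mk (idealN δ z ^ 1) P →
      PowerSeries.constantCoeff (toRingEquiv x) = Ideal.Quotient.mk (idealN δ z) P

variable {z}

/-- The Taylor expansion of Ore polynomials, with values in Laurent series. -/
def taylorPoly (τ : AdmissibleIso δ z) : OrePoly δ →+* LaurentSeries (ResRing δ z) :=
  (HahnSeries.ofPowerSeries ℤ (ResRing δ z)).comp
    ((τ.toRingEquiv : completion δ z →+* PowerSeries (ResRing δ z)).comp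
      ((toCompletion δ z).comp (toExt δ Fs)))

/-- The inclusion of `Fˢ` in the centre of `Kˢ[X; δ] / (N)`. -/
def resScalar : Fs →+* ResRing δ z :=
  (Ideal.Quotient.mk (idealN δ z)).comp ((oreC (extDeriv δ Fs)).comp (algebraMap Fs (ScalarExt δ Fs)))

/-- On the centre `F[Z(X)]`, the Taylor expansion is the usual one, `g(Z(X)) ↦ g(z + T)`. -/
theorem taylorPoly_zHom (τ : AdmissibleIso δ z) (g : (constants δ)[X]) :
    taylorPoly δ τ (zHom δ g) = HahnSeries.ofPowerSeries ℤ (ResRing δ z)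
      (PowerSeries.map (resScalar δ)
        (Polynomial.taylor z (g.map (algebraMap (constants δ) Fs)) : Fs[X])) := by
  have key : ((τ.toRingEquiv : completion δ z →+* PowerSeries (ResRing δ z)).comp
      ((toCompletion δ z).comp (toExt δ Fs))).comp (zHom δ) =
      ((PowerSeries.map (resScalar δ)).comp Polynomial.coeToPowerSeries.ringHom).comp
        ((Polynomial.taylorAlgHom z : Fs[X] →+* Fs[X]).comp
          (Polynomial.mapRingHom (algebraMap (constants δ) Fs))) := by
    apply Polynomial.ringHom_ext
    · intro a
      have h := τ.map_scalar (algebraMap Fs (ScalarExt δ Fs) (algebraMap (constants δ) Fs a))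
      simp only [RingHom.comp_apply, zHom_C, toExt_oreC, scalarK_const]
      refine h.trans ?_
      simp [resScalar]
    · have h := τ.map_N
      have h' := τ.map_scalar (algebraMap Fs (ScalarExt δ Fs) z)
      have hZ : toExt δ Fs (oreZ δ) =
          oreN δ z + oreC (extDeriv δ Fs) (algebraMap Fs (ScalarExt δ Fs) z) := by
        rw [oreN, sub_add_cancel]
      simp only [RingHom.comp_apply, zHom_X, hZ, map_add]
      refine (congrArg₂ (· + ·) h h').trans ?_
      simp [resScalar]
  exact congrArg (HahnSeries.ofPowerSeries ℤ (ResRing δ z)) (RingHom.congr_fun key g)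

theorem isUnit_taylorPoly_zHom (τ : AdmissibleIso δ z) {g : (constants δ)[X]} (hg : g ≠ 0) :
    IsUnit (taylorPoly δ τ (zHom δ g)) := by
  rw [taylorPoly_zHom]
  set p : PowerSeries Fs :=
    ((Polynomial.taylor z (g.map (algebraMap (constants δ) Fs)) : Fs[X]) : PowerSeries Fs)
  have hp : p ≠ 0 := by
    rw [Ne, Polynomial.coe_eq_zero_iff]
    intro h0
    have h1 := Polynomial.taylor_injective z (h0.trans (map_zero _).symm)
    exact hg ((Polynomial.map_eq_zero _).1 h1)
  have hT : IsUnit (HahnSeries.ofPowerSeries ℤ (ResRing δ z) PowerSeries.X) := by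
    rw [HahnSeries.ofPowerSeries_X]
    refine ⟨⟨HahnSeries.single 1 1, HahnSeries.single (-1) 1, ?_, ?_⟩, rfl⟩ <;>
    · rw [HahnSeries.single_mul_single, mul_one]; rfl
  rw [← PowerSeries.X_pow_order_mul_divXPowOrder (f := p),
    ← PowerSeries.Unit_of_divided_by_X_pow_order_nonzero hp, map_mul, map_mul, map_pow, map_pow,
    PowerSeries.map_X]
  exact (hT.pow _).mul (((Units.isUnit _).map _).map _)

theorem isUnit_taylorPoly (τ : AdmissibleIso δ z) {P : OrePoly δ} (hP : P ≠ 0) :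
    IsUnit (taylorPoly δ τ P) := by
  obtain ⟨D, hD, Q, h1, h2⟩ := exists_central_multiple δ hP
  obtain ⟨u, hu⟩ := isUnit_taylorPoly_zHom δ τ hD
  rw [isUnit_iff_exists_and_exists]
  refine ⟨⟨taylorPoly δ τ Q * (u⁻¹ : (LaurentSeries (ResRing δ z))ˣ), ?_⟩,
    ⟨(u⁻¹ : (LaurentSeries (ResRing δ z))ˣ) * taylorPoly δ τ Q, ?_⟩⟩
  · rw [← mul_assoc, ← map_mul, h1, ← hu, Units.mul_inv]
  · rw [mul_assoc, ← map_mul, h2, ← hu, Units.inv_mul]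

/-- The denominators, as units of the ring of Laurent series. -/
def taylorUnits (τ : AdmissibleIso δ z) : (OrePoly δ)⁰ →* (LaurentSeries (ResRing δ z))ˣ :=
  Units.liftRight (((taylorPoly δ τ : OrePoly δ →+* _) : OrePoly δ →* _).comp (OrePoly δ)⁰.subtype)
    (fun P => (isUnit_taylorPoly δ τ (nonZeroDivisors.coe_ne_zero P)).unit) fun _ => rfl

/-- The Taylor expansion `TS_z`: the unique extension of `taylorPoly` to a ring homomorphism from the
skew field of fractions to the ring of Laurent series over `Kˢ[X; δ] / (N)`. -/
def taylorSeries (τ : AdmissibleIso δ z) : OreFrac δ →+* LaurentSeries (ResRing δ z) :=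
  OreLocalization.universalHom (taylorPoly δ τ) (taylorUnits δ τ) fun _ => rfl

/-- The skew residue at `z` of an element of the skew field of fractions, with respect to an
admissible isomorphism. -/
def sres (τ : AdmissibleIso δ z) (f : OreFrac δ) : ResRing δ z := (taylorSeries δ τ f).coeff (-1)

/-- Right multiplication `x ↦ x y` on `Kˢ[X; δ] / (N)`, a `Kˢ`-linear endomorphism. -/
def resRightMul (y : ResRing δ z) : ResRing δ z →ₗ[ScalarExt δ Fs] ResRing δ z where
  toFun x := x * y
  map_add' x x' := add_mul x x' y
  map_smul' a x := by
    obtain ⟨x, rfl⟩ := Ideal.Quotient.mk_surjective x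
    obtain ⟨y, rfl⟩ := Ideal.Quotient.mk_surjective y
    exact congrArg (Ideal.Quotient.mk (idealN δ z)) (smul_mul_assoc a x y)

/-- The reduced trace on `Kˢ[X; δ] / (N)`: the trace of right multiplication on this left module
over the image `Kˢ[Z(X)] / (Z(X) - z) = Kˢ` of `Kˢ[Z(X)]`. -/
def resReducedTrace (y : ResRing δ z) : ScalarExt δ Fs :=
  LinearMap.trace (ScalarExt δ Fs) (ResRing δ z) (resRightMul δ y)

open scoped RatFunc in
/-- The residue at `z ∈ Fˢ` of the differential form `g(Y) dY`, for `g ∈ F(Y)`: the coefficient of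
`T⁻¹` in the Laurent expansion of `g(z + T)`. -/
def residue (z : Fs) (g : RatFunc (constants δ)) : Fs :=
  (algebraMap (RatFunc Fs) (LaurentSeries Fs) (RatFunc.laurent z (IsFractionRing.map (K := RatFunc (constants δ)) (L := RatFunc Fs)
    (j := Polynomial.mapRingHom (algebraMap (constants δ) Fs))
    (Polynomial.map_injective _ (algebraMap (constants δ) Fs).injective) g))).coeff (-1)

end Taylor

end SkewResidue

end

noncomputable section

open scoped Polynomial TensorProduct nonZeroDivisors

namespace SkewResidue

/-! ### Division by monic Ore polynomials and bases -/

section Division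

variable {R : Type*} [CommRing R] (δ : Derivation ℤ R R)

/-! Let `s` be the degree of `Z`. Right division by the monic Ore polynomial `Z(X)` shows that `1,
X, …, Xˢ⁻¹` is a basis of `𝒜⁺` over `C⁺ = K[Y]`, where `Y = Z(X)`. Division by `N = Z(X) - z` shows
that the same powers of the class `x` of `X` form a basis of `R_z` over `Kˢ`, hence of `R_z[[T]]`
over `Kˢ[[T]]`. All reduced traces thus become traces of `s × s` matrices; let `M` over `K[Y]` be
the matrix of `x ↦ x P`.

Rationality (`coeffDelta_reducedTrace`). Let `B` be the matrix of right multiplication by `X`.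
Expanding `X · Xʲ · P` in two ways gives `δ(M) = B M - M B`, with `δ` acting on the coefficients of
the entries. A commutator has trace zero, so the coefficients of `Trd(P)` are constants and `Trd(P)`
lies in `F[Y]`.

Comparison (`trace_psCoord_taylorPS`). Given an admissible `τ`, let `U` hold the coordinates of the
expansions of the `Xʲ` in the basis `xᵏ`, and let `W` be the matrix of right multiplication by the
expansion of `P`. Expanding the image of `Xʲ P` in two ways gives `U W = M(z + T) U`. Since `τ` is
the identity modulo `T`, `U` is congruent to `1` modulo `T`, hence invertible. So `W` and `M(z + T)`
are conjugate and have the same trace: the trace, taken coefficient by coefficient, turns the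
expansion of `P` into that of `Trd(P)`, whatever `τ` is.

Fractions (`map_resTraceHom_taylorSeries`). Write `f = D⁻¹ P` with `D` in the centre. The expansion
of `D` has coefficients in the image of `Fˢ`, over which the trace on `R_z` is linear, so the
expansion of `D` can be divided out of the traces. The theorem is the equality of the coefficients
of `T⁻¹`. -/

/-- Uniqueness of right division by a monic Ore polynomial. -/
theorem eq_zero_of_oreMul_monic_add {W : R[X]} (hW : W.Monic) {Q r : R[X]}
    (hr : ∀ k, W.natDegree ≤ k → r.coeff k = 0) (h : oreMul δ Q W + r = 0) : Q = 0 := by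
  have h1 := (natDegree_oreMul δ Q W _ _ le_rfl le_rfl).2
  -- In this degree `r` contributes nothing and the product contributes the leading coefficient of
  -- `Q` times `1`. Monicity of `W` replaces the absence of zero divisors, so the argument applies
  -- over `Kˢ`.
  have h2 := congrArg (fun p => Polynomial.coeff p (Q.natDegree + W.natDegree)) h
  simp only [Polynomial.coeff_add, h1, hr _ (Nat.le_add_left _ _), hW.coeff_natDegree, mul_one,
    add_zero, Polynomial.coeff_natDegree, Polynomial.coeff_zero] at h2
  exact Polynomial.leadingCoeff_eq_zero.1 h2

theorem sum_smul_oreX_pow {s : ℕ} (g : Fin s → R) :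
    ∑ j : Fin s, g j • oreX δ ^ (j : ℕ) =
      ofPoly δ (∑ j : Fin s, Polynomial.monomial (j : ℕ) (g j)) := by
  rw [map_sum]
  exact Finset.sum_congr rfl fun j _ => (ofPoly_monomial δ _ _).symm

theorem coeff_sum_monomial_fin {s : ℕ} (g : Fin s → R) :
    (∀ k, s ≤ k → (∑ j : Fin s, Polynomial.monomial (j : ℕ) (g j)).coeff k = 0) ∧
      ∀ i : Fin s, (∑ j : Fin s, Polynomial.monomial (j : ℕ) (g j)).coeff i = g i := by
  constructor
  · intro k hk
    rw [Polynomial.finsetSum_coeff]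
    refine Finset.sum_eq_zero fun j _ => ?_
    rw [Polynomial.coeff_monomial, if_neg]
    omega
  · intro i
    rw [Polynomial.finsetSum_coeff, Finset.sum_eq_single i]
    · rw [Polynomial.coeff_monomial, if_pos rfl]
    · intro j _ hj
      rw [Polynomial.coeff_monomial, if_neg]
      exact fun h => hj (Fin.ext h)
    · simp

/-- Uniqueness of quotient and remainder, in the form that serves both for `Z(X)` over `K` and for
`N` over `Kˢ`. -/
theorem mul_monic_add_sum_eq_zero {W : R[X]} (hW : W.Monic) {s : ℕ} (hs : W.natDegree = s)
    {Q : OrePoly δ} {g : Fin s → R} (h : Q * ofPoly δ W + ∑ j, g j • oreX δ ^ (j : ℕ) = 0) :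
    Q = 0 ∧ g = 0 := by
  subst hs
  rw [sum_smul_oreX_pow] at h
  have hQ : Q = 0 := eq_zero_of_oreMul_monic_add δ hW (coeff_sum_monomial_fin g).1 h
  refine ⟨hQ, funext fun i => ?_⟩
  rw [hQ, zero_mul, zero_add] at h
  rw [← (coeff_sum_monomial_fin g).2 i]
  exact congrArg (fun p => Polynomial.coeff p i) h

end Division

/-! ### The basis of `𝒜⁺` over `C⁺` and matrices of right multiplication. -/

section Field

variable {K : Type*} [Field K] (δ : Derivation ℤ K K)

/-- The derivation `δ` applied to the coefficients of a polynomial. -/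
def coeffDelta : K[X] →+ K[X] :=
  (leftX δ - LinearMap.mulLeft ℤ (Polynomial.X : K[X])).toAddMonoidHom

theorem coeff_coeffDelta (p : K[X]) (n : ℕ) : (coeffDelta δ p).coeff n = δ (p.coeff n) := by
  change (leftX δ p - Polynomial.X * p).coeff n = _
  rw [Polynomial.coeff_sub, coeff_leftX, add_sub_cancel_left]

variable [FiniteDimensional (constants δ) K]

/-- In a relation with coefficients `pⱼ(Y)`, split `pⱼ` into `Y` times a quotient and a constant
term. Since `Y` is the central element `Z(X)`, this is a right division by `Z(X)`: the constant
terms vanish and the quotients satisfy a relation of the same kind. Iterating removes the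
coefficients one after the other. -/
theorem linearIndependent_oreX_pow :
    LinearIndependent K[X] fun j : Fin (minZ δ).natDegree => oreX δ ^ (j : ℕ) := by
  rw [Fintype.linearIndependent_iff]
  have hW : ((minZ δ).map (algebraMap (constants δ) K)).Monic := (minZ_monic δ).map _
  have hd : ((minZ δ).map (algebraMap (constants δ) K)).natDegree = (minZ δ).natDegree :=
    (minZ_monic δ).natDegree_map _
  have key : ∀ (n : ℕ) (p : Fin (minZ δ).natDegree → K[X]),
      ∑ j, p j • oreX δ ^ (j : ℕ) = 0 → ∀ j, (p j).coeff n = 0 := by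
    intro n
    have step : ∀ p : Fin (minZ δ).natDegree → K[X], ∑ j, p j • oreX δ ^ (j : ℕ) = 0 →
        ∑ j, (p j).divX • oreX δ ^ (j : ℕ) = 0 ∧ (fun j => (p j).coeff 0) = 0 := by
      intro p hp
      have h1 : ∀ j, p j • oreX δ ^ (j : ℕ) =
          ((p j).divX • oreX δ ^ (j : ℕ)) * oreZ δ + (p j).coeff 0 • oreX δ ^ (j : ℕ) := by
        intro j
        conv_lhs => rw [← Polynomial.divX_mul_X_add (p j)]
        rw [add_smul, cModule_smul, cModule_smul, cModule_smul, map_mul, cHom_X, cHom_C, oreC_mul,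
          mul_assoc, mul_assoc, oreZ_central]
      rw [Finset.sum_congr rfl fun j _ => h1 j, Finset.sum_add_distrib, ← Finset.sum_mul] at hp
      exact mul_monic_add_sum_eq_zero δ hW hd hp
    induction n with
    | zero => exact fun p hp j => congrFun (step p hp).2 j
    | succ n ih =>
      intro p hp j
      rw [← Polynomial.coeff_divX]
      exact ih _ (step p hp).1 j
  intro p hp j
  ext n
  exact key n p hp j

theorem span_oreX_pow :
    ⊤ ≤ Submodule.span K[X] (Set.range fun j : Fin (minZ δ).natDegree => oreX δ ^ (j : ℕ)) := by
  set S := Submodule.span K[X] (Set.range fun j : Fin (minZ δ).natDegree => oreX δ ^ (j : ℕ))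
  intro P _
  induction P using orePoly_induction with
  | hadd P Q hP hQ => exact S.add_mem (hP trivial) (hQ trivial)
  | hmon n a =>
    refine zHom_smul_monomial_mem δ (M := S.toAddSubgroup) ?_ ?_ n a
    · intro D P hP
      exact S.smul_mem (D.map (algebraMap (constants δ) K)) hP
    · intro a i hi
      have h : a • oreX δ ^ i = Polynomial.C a • oreX δ ^ i := by
        rw [cModule_smul, cHom_C, oreC_mul]
      rw [h]
      exact S.smul_mem _ (Submodule.subset_span ⟨⟨i, hi⟩, rfl⟩)

/-- The basis `1, X, …, Xˢ⁻¹` of `K[X; δ]` over `K[Z(X)]`, where `s` is the degree of `Z`. -/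
def oreBasis : Module.Basis (Fin (minZ δ).natDegree) K[X] (OrePoly δ) :=
  Module.Basis.mk (linearIndependent_oreX_pow δ) (span_oreX_pow δ)

theorem oreBasis_apply (j : Fin (minZ δ).natDegree) : oreBasis δ j = oreX δ ^ (j : ℕ) :=
  Module.Basis.mk_apply _ _ _

/-- The matrix of right multiplication by an Ore polynomial: `Xʲ P = ∑ₖ Mⱼₖ Xᵏ`. -/
def rightMatrix (P : OrePoly δ) :
    Matrix (Fin (minZ δ).natDegree) (Fin (minZ δ).natDegree) K[X] :=
  fun j k => (oreBasis δ).repr (oreX δ ^ (j : ℕ) * P) k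

theorem oreX_pow_mul (P : OrePoly δ) (j : Fin (minZ δ).natDegree) :
    oreX δ ^ (j : ℕ) * P = ∑ k, rightMatrix δ P j k • oreX δ ^ (k : ℕ) := by
  conv_lhs => rw [← (oreBasis δ).sum_repr (oreX δ ^ (j : ℕ) * P)]
  simp only [oreBasis_apply, rightMatrix]

/-- `rightMatrix` is the transpose of `LinearMap.toMatrix`, with the same diagonal. The row
convention suits coefficients written on the left: right multiplication by `P Q` has matrix `M(P)
M(Q)`. -/
theorem reducedTrace_eq (P : OrePoly δ) : reducedTrace δ P = (rightMatrix δ P).trace := by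
  rw [reducedTrace, LinearMap.trace_eq_matrix_trace _ (oreBasis δ)]
  refine Finset.sum_congr rfl fun j _ => ?_
  rw [Matrix.diag_apply, LinearMap.toMatrix_apply, oreBasis_apply]
  rfl

/-! ### The reduced trace has constant coefficients -/

/-- `Z(X)` commutes with `X`, so moving `X` across an element of `K[Z(X)]` differentiates only its
coefficients in `K`. -/
theorem oreX_mul_cHom (p : K[X]) :
    oreX δ * cHom δ p = cHom δ p * oreX δ + cHom δ (coeffDelta δ p) := by
  induction p using Polynomial.induction_on' with
  | add p q hp hq => rw [map_add, map_add, map_add, mul_add, add_mul, hp, hq]; abel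
  | monomial n a =>
    have h : ∀ b, cHom δ (Polynomial.monomial n b) = oreC δ b * oreZ δ ^ n := fun b => by
      rw [← Polynomial.C_mul_X_pow_eq_monomial, map_mul, map_pow, cHom_C, cHom_X]
    have hD : coeffDelta δ (Polynomial.monomial n a) = Polynomial.monomial n (δ a) := by
      ext k
      rw [coeff_coeffDelta, Polynomial.coeff_monomial, Polynomial.coeff_monomial]
      split_ifs <;> simp
    have hZ : Commute (oreZ δ ^ n) (oreX δ) :=
      Commute.pow_left (show _ * _ = _ * _ from (oreX_mul_oreZ δ).symm) n
    rw [hD, h, h, ← mul_assoc, oreX_mul_oreC, add_mul, ← oreC_mul, mul_assoc, mul_assoc, hZ.eq]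

/-- The derivative of the matrix of `P` is its commutator with the matrix of `X`, and a commutator
over a commutative ring has trace zero. -/
theorem coeffDelta_reducedTrace (P : OrePoly δ) : coeffDelta δ (reducedTrace δ P) = 0 := by
  set M := rightMatrix δ P
  set B := rightMatrix δ (oreX δ)
  -- `B` describes multiplication by `X` on the right, but powers of `X` commute, so it also
  -- describes `X` acting on the left on basis elements.
  have hX : ∀ j : Fin (minZ δ).natDegree,
      oreX δ * oreX δ ^ (j : ℕ) = ∑ k, B j k • oreX δ ^ (k : ℕ) := fun j => by
    rw [← pow_succ', pow_succ, oreX_pow_mul]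
  have key : M.map (coeffDelta δ) = B * M - M * B := by
    rw [eq_sub_iff_add_eq]
    ext1 j k
    -- Grouped as `(X Xʲ) P`: expand by `B`, then by `M`.
    have h1 : oreX δ * oreX δ ^ (j : ℕ) * P =
        ∑ k, (B * M) j k • oreX δ ^ (k : ℕ) := by
      rw [hX, Finset.sum_mul]
      simp only [cModule_smul, mul_assoc, oreX_pow_mul]
      simp only [← cModule_smul, Finset.smul_sum, smul_smul]
      rw [Finset.sum_comm]
      simp only [← Finset.sum_smul, Matrix.mul_apply, M]
    -- Grouped as `X (Xʲ P)`: expand by `M`, then move `X` past its entries, which produces the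
    -- derivative term.
    have h2 : oreX δ * oreX δ ^ (j : ℕ) * P =
        ∑ k, (M.map (coeffDelta δ) + M * B) j k • oreX δ ^ (k : ℕ) := by
      rw [mul_assoc, oreX_pow_mul, Finset.mul_sum]
      simp only [cModule_smul, ← mul_assoc, oreX_mul_cHom, add_mul]
      simp only [mul_assoc, hX]
      simp only [← cModule_smul, Finset.smul_sum, smul_smul, Matrix.add_apply, add_smul,
        Finset.sum_add_distrib, Matrix.map_apply]
      rw [add_comm, Finset.sum_comm]
      simp only [← Finset.sum_smul, Matrix.mul_apply, M]
    have h3 := h2.symm.trans h1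
    simp only [← oreBasis_apply] at h3
    have h4 := congrArg (fun v => (oreBasis δ).repr v k) h3
    simpa only [Module.Basis.repr_sum_self] using h4
  have h := congrArg Matrix.trace key
  rw [Matrix.trace_sub, Matrix.trace_mul_comm, sub_self] at h
  rw [reducedTrace_eq, ← h, Matrix.trace, map_sum]
  rfl

/-- The reduced trace takes values in `F[Z(X)]`. -/
theorem exists_map_eq_reducedTrace (P : OrePoly δ) :
    ∃ t : (constants δ)[X], t.map (algebraMap (constants δ) K) = reducedTrace δ P := by
  refine (Polynomial.mem_lifts _).1 ?_
  rw [Polynomial.lifts_iff_coeff_lifts]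
  intro k
  refine ⟨⟨(reducedTrace δ P).coeff k, ?_⟩, rfl⟩
  rw [mem_constants, ← coeff_coeffDelta, coeffDelta_reducedTrace, Polynomial.coeff_zero]

end Field

/-! ### The quotient `Kˢ[X; δ] / (N)` -/

section Quotient

variable {K : Type*} [Field K] (δ : Derivation ℤ K K)
variable {Fs : Type*} [Field Fs] [Algebra (constants δ) Fs] (z : Fs)

/-- Needed for monic polynomials to keep their degree when mapped to `Kˢ`. -/
instance : Nontrivial (ScalarExt δ Fs) := inferInstanceAs (Nontrivial (Fs ⊗[constants δ] K))

/-- The polynomial `Z - z` over `Kˢ`. -/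
def polyN : (ScalarExt δ Fs)[X] :=
  ((minZ δ).map (algebraMap (constants δ) K)).map (scalarK δ Fs) -
    Polynomial.C (algebraMap Fs (ScalarExt δ Fs) z)

theorem ofPoly_polyN : ofPoly (extDeriv δ Fs) (polyN δ z) = oreN δ z := by
  change polyN δ z = ((minZ δ).map (algebraMap (constants δ) K)).map (scalarK δ Fs) -
    algebraMap Fs (ScalarExt δ Fs) z • (1 : (ScalarExt δ Fs)[X])
  rw [polyN, Polynomial.smul_eq_C_mul, mul_one]

variable [FiniteDimensional (constants δ) K]

theorem minZ_natDegree_pos : 0 < (minZ δ).natDegree :=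
  minpoly.natDegree_pos (Algebra.IsIntegral.isIntegral _)

theorem polyN_natDegree : (polyN δ z).natDegree = (minZ δ).natDegree := by
  rw [polyN, Polynomial.natDegree_sub_C, ((minZ_monic δ).map _).natDegree_map,
    (minZ_monic δ).natDegree_map]

theorem polyN_monic : (polyN δ z).Monic := by
  have h : (((minZ δ).map (algebraMap (constants δ) K)).map (scalarK δ Fs)).Monic :=
    ((minZ_monic δ).map _).map _
  -- As `s > 0`, the constant `z` lies strictly below the leading term.
  refine h.sub_of_left (Polynomial.degree_C_le.trans_lt ?_)
  rw [Polynomial.degree_eq_natDegree h.ne_zero, ((minZ_monic δ).map _).natDegree_map,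
    (minZ_monic δ).natDegree_map]
  exact_mod_cast minZ_natDegree_pos δ

/-- The inclusion of `Kˢ` in `Kˢ[X; δ] / (N)`. -/
def resC : ScalarExt δ Fs →+* ResRing δ z :=
  (Ideal.Quotient.mk (idealN δ z)).comp (oreC (extDeriv δ Fs))

theorem resC_mul (a : ScalarExt δ Fs) (y : ResRing δ z) : resC δ z a * y = a • y := by
  obtain ⟨y, rfl⟩ := Ideal.Quotient.mk_surjective y
  exact congrArg (Ideal.Quotient.mk (idealN δ z)) (oreC_mul (extDeriv δ Fs) a y)

/-- The class of `X` in `Kˢ[X; δ] / (N)`. -/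
def resX : ResRing δ z := Ideal.Quotient.mk (idealN δ z) (oreX (extDeriv δ Fs))

theorem resX_mul_smul (a : ScalarExt δ Fs) (y : ResRing δ z) :
    resX δ z * a • y = a • (resX δ z * y) + extDeriv δ Fs a • y := by
  obtain ⟨y, rfl⟩ := Ideal.Quotient.mk_surjective y
  refine congrArg (Ideal.Quotient.mk (idealN δ z))
    (?_ : oreX _ * a • y = a • (oreX _ * y) + extDeriv δ Fs a • y)
  rw [← oreC_mul, ← mul_assoc, oreX_mul_oreC, add_mul, smul_mul_assoc, oreC_mul]

theorem mk_sum_smul_oreX_pow {n : ℕ} (g : Fin n → ScalarExt δ Fs) :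
    Ideal.Quotient.mk (idealN δ z) (∑ j, g j • oreX (extDeriv δ Fs) ^ (j : ℕ)) =
      ∑ j, g j • resX δ z ^ (j : ℕ) := by
  simp only [map_sum, ← oreC_mul, ← resC_mul, map_mul, map_pow]
  rfl

/-- A relation among these powers lifts to a left multiple of `N` of degree less than `s`, which
uniqueness of division by `N` forces to be zero. -/
theorem linearIndependent_resX_pow :
    LinearIndependent (ScalarExt δ Fs) fun j : Fin (minZ δ).natDegree => resX δ z ^ (j : ℕ) := by
  rw [Fintype.linearIndependent_iff]
  intro g hg
  rw [← mk_sum_smul_oreX_pow, Ideal.Quotient.eq_zero_iff_mem] at hg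
  obtain ⟨a, ha⟩ := Ideal.mem_span_singleton'.1 hg
  rw [← ofPoly_polyN, eq_comm, ← sub_eq_zero, sub_eq_add_neg, ← neg_mul, add_comm] at ha
  exact congrFun (mul_monic_add_sum_eq_zero _ (polyN_monic δ z) (polyN_natDegree δ z) ha).2

theorem span_resX_pow :
    ⊤ ≤ Submodule.span (ScalarExt δ Fs)
      (Set.range fun j : Fin (minZ δ).natDegree => resX δ z ^ (j : ℕ)) := by
  set S := Submodule.span (ScalarExt δ Fs)
    (Set.range fun j : Fin (minZ δ).natDegree => resX δ z ^ (j : ℕ))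
  have hS : ∀ i < (minZ δ).natDegree, resX δ z ^ i ∈ S := fun i hi =>
    Submodule.subset_span ⟨⟨i, hi⟩, rfl⟩
  -- `N` vanishes in the quotient and is monic of degree `s`, so `xˢ` is a combination of lower
  -- powers.
  have hs : resX δ z ^ (minZ δ).natDegree ∈ S := by
    have h0 : Ideal.Quotient.mk (idealN δ z) (oreN δ z) = 0 :=
      Ideal.Quotient.eq_zero_iff_mem.2 (Ideal.mem_span_singleton_self _)
    have h1 := (polyN_monic δ z).as_sum
    rw [polyN_natDegree] at h1
    rw [← ofPoly_polyN, h1, map_add, map_sum] at h0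
    rw [← Polynomial.monomial_one_right_eq_X_pow] at h0
    simp only [Polynomial.C_mul_X_pow_eq_monomial, ofPoly_monomial, one_smul] at h0
    rw [Finset.sum_range fun i => (polyN δ z).coeff i • oreX (extDeriv δ Fs) ^ i, map_add,
      mk_sum_smul_oreX_pow] at h0
    have h2 : resX δ z ^ (minZ δ).natDegree =
        -∑ j : Fin (minZ δ).natDegree, (polyN δ z).coeff j • resX δ z ^ (j : ℕ) :=
      eq_neg_of_add_eq_zero_left h0
    rw [h2]
    exact S.neg_mem (S.sum_mem fun j _ => S.smul_mem _ (hS j j.2))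
  -- Left multiplication by `x` is not `Kˢ`-linear, but `x a = a x + δ(a)` makes the error term a
  -- multiple of an element already in `S`.
  have hX : ∀ y ∈ S, resX δ z * y ∈ S := by
    intro y hy
    induction hy using Submodule.span_induction with
    | mem y hy =>
      obtain ⟨j, rfl⟩ := hy
      rw [← pow_succ']
      rcases (Nat.succ_le_of_lt j.2).eq_or_lt with h | h
      · rwa [show (j : ℕ) + 1 = (minZ δ).natDegree from h]
      · exact hS _ h
    | zero => rw [mul_zero]; exact S.zero_mem
    | add x y _ _ hx hy => rw [mul_add]; exact S.add_mem hx hy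
    | smul a y hy' hy =>
      rw [resX_mul_smul]
      exact S.add_mem (S.smul_mem _ hy) (S.smul_mem _ hy')
  have hpow : ∀ n, resX δ z ^ n ∈ S := by
    intro n
    induction n with
    | zero => exact hS 0 (minZ_natDegree_pos δ)
    | succ n ih => rw [pow_succ']; exact hX _ ih
  intro y _
  obtain ⟨P, rfl⟩ := Ideal.Quotient.mk_surjective y
  induction P using orePoly_induction with
  | hadd P Q hP hQ => rw [map_add]; exact S.add_mem (hP trivial) (hQ trivial)
  | hmon n a => exact S.smul_mem a (hpow n)

/-- The basis `1, x, …, xˢ⁻¹` of `Kˢ[X; δ] / (N)` over `Kˢ`. -/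
def resBasis : Module.Basis (Fin (minZ δ).natDegree) (ScalarExt δ Fs) (ResRing δ z) :=
  Module.Basis.mk (linearIndependent_resX_pow δ z) (span_resX_pow δ z)

theorem resBasis_apply (j : Fin (minZ δ).natDegree) : resBasis δ z j = resX δ z ^ (j : ℕ) :=
  Module.Basis.mk_apply _ _ _

theorem resReducedTrace_eq (y : ResRing δ z) :
    resReducedTrace δ y = ∑ k : Fin (minZ δ).natDegree, (resBasis δ z).repr (resX δ z ^ (k : ℕ) * y) k := by
  rw [resReducedTrace, LinearMap.trace_eq_matrix_trace _ (resBasis δ z)]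
  refine Finset.sum_congr rfl fun j _ => ?_
  rw [Matrix.diag_apply, LinearMap.toMatrix_apply, resBasis_apply]
  rfl

/-- Right multiplication by `a y` is `a` times right multiplication by `y` only when `a` can be
moved past the argument, hence the centrality assumption. It holds for scalars from `Fˢ`. -/
theorem resReducedTrace_smul (a : ScalarExt δ Fs) (y : ResRing δ z)
    (ha : ∀ x : ResRing δ z, x * resC δ z a = resC δ z a * x) :
    resReducedTrace δ (resC δ z a * y) = a * resReducedTrace δ y := by
  have : resRightMul δ (resC δ z a * y) = a • resRightMul δ y := by
    refine LinearMap.ext fun x => ?_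
    change x * (resC δ z a * y) = a • (x * y)
    rw [← mul_assoc, ha, mul_assoc, resC_mul]
  rw [resReducedTrace, this, map_smul, smul_eq_mul, resReducedTrace]

/-- The reduced trace on `Kˢ[X; δ] / (N)` is `Fˢ`-linear. -/
theorem resReducedTrace_resScalar_mul (c : Fs) (y : ResRing δ z) :
    resReducedTrace δ (resScalar δ c * y) = algebraMap Fs (ScalarExt δ Fs) c * resReducedTrace δ y :=
  resReducedTrace_smul δ z _ y fun x => by
    obtain ⟨x, rfl⟩ := Ideal.Quotient.mk_surjective x
    exact congrArg (Ideal.Quotient.mk (idealN δ z)) (oreC_ext_central δ Fs c x)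

/-- The reduced trace as an additive map. -/
def resTraceHom : ResRing δ z →+ ScalarExt δ Fs where
  toFun := resReducedTrace δ
  map_zero' := by
    rw [resReducedTrace_eq]
    simp
  map_add' x y := by
    simp only [resReducedTrace_eq, mul_add, map_add, Finsupp.add_apply, Finset.sum_add_distrib]

/-! ### Coordinates of power series over the quotient -/

/-- The coordinates of a power series over `Kˢ[X; δ] / (N)`. -/
def psCoord (y : PowerSeries (ResRing δ z)) (k : Fin (minZ δ).natDegree) :
    PowerSeries (ScalarExt δ Fs) :=
  PowerSeries.mk fun n => (resBasis δ z).repr (PowerSeries.coeff n y) k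

theorem coeff_sum_map_resC_mul (u : Fin (minZ δ).natDegree → PowerSeries (ScalarExt δ Fs)) (n : ℕ) :
    PowerSeries.coeff n (∑ k, PowerSeries.map (resC δ z) (u k) *
      PowerSeries.C (resX δ z ^ (k : ℕ))) =
      ∑ k, PowerSeries.coeff n (u k) • resBasis δ z k := by
  simp only [map_sum, PowerSeries.coeff_mul_C, PowerSeries.coeff_map, resC_mul, resBasis_apply]

/-- With `psCoord_sum`, this says that the constants `xᵏ` form a basis of `R_z[[T]]` over `Kˢ[[T]]`,
acting on the left. -/
theorem sum_psCoord (y : PowerSeries (ResRing δ z)) :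
    ∑ k, PowerSeries.map (resC δ z) (psCoord δ z y k) * PowerSeries.C (resX δ z ^ (k : ℕ)) = y := by
  ext n
  rw [coeff_sum_map_resC_mul]
  simp only [psCoord, PowerSeries.coeff_mk]
  exact (resBasis δ z).sum_repr _

theorem psCoord_sum (u : Fin (minZ δ).natDegree → PowerSeries (ScalarExt δ Fs)) :
    psCoord δ z (∑ k, PowerSeries.map (resC δ z) (u k) * PowerSeries.C (resX δ z ^ (k : ℕ))) = u := by
  ext k n
  rw [psCoord, PowerSeries.coeff_mk, coeff_sum_map_resC_mul, Module.Basis.repr_sum_self]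

end Quotient

/-! ### Traces of Taylor expansions -/

section Taylor

variable {K : Type*} [Field K] (δ : Derivation ℤ K K)
variable {Fs : Type*} [Field Fs] [Algebra (constants δ) Fs] {z : Fs}

variable (z) in
/-- The Taylor expansion `p ↦ p(z + T)` on `K[Y]`. -/
def taylorK : K[X] →+* PowerSeries (ScalarExt δ Fs) :=
  Polynomial.coeToPowerSeries.ringHom.comp
    ((Polynomial.taylorAlgHom (algebraMap Fs (ScalarExt δ Fs) z) :
      (ScalarExt δ Fs)[X] →+* (ScalarExt δ Fs)[X]).comp (Polynomial.mapRingHom (scalarK δ Fs)))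

/-- Both sides are ring homomorphisms in `t`, so it suffices to check constants and the variable.
Constants agree because `1 ⊗ a = a ⊗ 1` for `a ∈ F`. -/
theorem taylorK_map (t : (constants δ)[X]) :
    taylorK δ z (t.map (algebraMap (constants δ) K)) =
      PowerSeries.map (algebraMap Fs (ScalarExt δ Fs))
        (Polynomial.taylor z (t.map (algebraMap (constants δ) Fs)) : Fs[X]) := by
  refine RingHom.congr_fun
    (f := (taylorK δ z).comp (Polynomial.mapRingHom (algebraMap (constants δ) K)))
    (g := ((PowerSeries.map (algebraMap Fs (ScalarExt δ Fs))).comp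
      Polynomial.coeToPowerSeries.ringHom).comp ((Polynomial.taylorAlgHom z : Fs[X] →+* Fs[X]).comp
          (Polynomial.mapRingHom (algebraMap (constants δ) Fs)))) ?_ t
  apply Polynomial.ringHom_ext
  · intro a
    have h : scalarK δ Fs (algebraMap (constants δ) K a) = _ := scalarK_const δ Fs a
    simpa [taylorK] using congrArg PowerSeries.C h
  · simp [taylorK]

variable [FiniteDimensional (constants δ) K]

/-- The Taylor expansion of Ore polynomials, with values in power series. -/
def taylorPS (τ : AdmissibleIso δ z) : OrePoly δ →+* PowerSeries (ResRing δ z) :=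
  (τ.toRingEquiv : completion δ z →+* PowerSeries (ResRing δ z)).comp
    ((toCompletion δ z).comp (toExt δ Fs))

/-- On `C⁺` an admissible isomorphism leaves no freedom: it fixes `Kˢ` and sends `Z(X) = z + N` to
`z + T`. -/
theorem taylorPS_cHom (τ : AdmissibleIso δ z) (p : K[X]) :
    taylorPS δ τ (cHom δ p) = PowerSeries.map (resC δ z) (taylorK δ z p) := by
  refine RingHom.congr_fun (f := (taylorPS δ τ).comp (cHom δ))
    (g := (PowerSeries.map (resC δ z)).comp (taylorK δ z)) ?_ p
  apply Polynomial.ringHom_ext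
  · intro a
    have h := τ.map_scalar (scalarK δ Fs a)
    simp only [RingHom.comp_apply, taylorPS, cHom_C, toExt_oreC]
    refine h.trans ?_
    simp [resC, taylorK]
  · have h := τ.map_N
    have h' := τ.map_scalar (algebraMap Fs (ScalarExt δ Fs) z)
    have hZ : toExt δ Fs (oreZ δ) =
        oreN δ z + oreC (extDeriv δ Fs) (algebraMap Fs (ScalarExt δ Fs) z) := by
      rw [oreN, sub_add_cancel]
    simp only [RingHom.comp_apply, taylorPS, cHom_X, hZ, map_add]
    refine (congrArg₂ (· + ·) h h').trans ?_
    simp [resC, taylorK]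

theorem constantCoeff_taylorPS_oreX_pow (τ : AdmissibleIso δ z) (j : ℕ) :
    PowerSeries.constantCoeff (taylorPS δ τ (oreX δ ^ j)) = resX δ z ^ j := by
  have h := τ.residual (toCompletion δ z (toExt δ Fs (oreX δ ^ j))) _ rfl
  refine h.trans ?_
  rw [map_pow, toExt_oreX, map_pow, resX]

/-- The expansions of the `Xʲ` are a second basis of `R_z[[T]]`, in which right multiplication by
the expansion of `P` has matrix `M(z + T)`. The trace does not depend on the basis. -/
theorem trace_psCoord_taylorPS (τ : AdmissibleIso δ z) (P : OrePoly δ) :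
    ∑ k : Fin (minZ δ).natDegree, psCoord δ z (PowerSeries.C (resX δ z ^ (k : ℕ)) * taylorPS δ τ P) k =
      taylorK δ z (reducedTrace δ P) := by
  set U : Matrix (Fin (minZ δ).natDegree) (Fin (minZ δ).natDegree) (PowerSeries (ScalarExt δ Fs)) :=
    Matrix.of fun j => psCoord δ z (taylorPS δ τ (oreX δ ^ (j : ℕ))) with hU
  set W : Matrix (Fin (minZ δ).natDegree) (Fin (minZ δ).natDegree) (PowerSeries (ScalarExt δ Fs)) :=
    Matrix.of fun k =>
      psCoord δ z (PowerSeries.C (resX δ z ^ (k : ℕ)) * taylorPS δ τ P) with hW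
  set M := (taylorK (Fs := Fs) δ z).mapMatrix (rightMatrix δ P) with hM
  have key : U * W = M * U := by
    ext1 j k
    have h1 : taylorPS δ τ (oreX δ ^ (j : ℕ) * P) =
        ∑ k, PowerSeries.map (resC δ z) ((U * W) j k) * PowerSeries.C (resX δ z ^ (k : ℕ)) := by
      rw [map_mul]
      conv_lhs => rw [← sum_psCoord δ z (taylorPS δ τ (oreX δ ^ (j : ℕ))), Finset.sum_mul]
      simp only [mul_assoc]
      conv_lhs =>
        enter [2, l]
        rw [← sum_psCoord δ z (PowerSeries.C (resX δ z ^ (l : ℕ)) * taylorPS δ τ P),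
          Finset.mul_sum]
      rw [Finset.sum_comm]
      simp only [Matrix.mul_apply, map_sum, map_mul, Finset.sum_mul, mul_assoc, hU, hW,
        Matrix.of_apply]
    have h2 : taylorPS δ τ (oreX δ ^ (j : ℕ) * P) =
        ∑ k, PowerSeries.map (resC δ z) ((M * U) j k) * PowerSeries.C (resX δ z ^ (k : ℕ)) := by
      rw [oreX_pow_mul, map_sum]
      simp only [cModule_smul, map_mul (taylorPS δ τ), taylorPS_cHom]
      conv_lhs =>
        enter [2, l]
        rw [← sum_psCoord δ z (taylorPS δ τ (oreX δ ^ (l : ℕ))), Finset.mul_sum]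
      rw [Finset.sum_comm]
      simp only [Matrix.mul_apply, map_sum, map_mul, Finset.sum_mul, mul_assoc, hU, hM,
        RingHom.mapMatrix_apply, Matrix.map_apply, Matrix.of_apply]
    have h3 := congrArg (psCoord δ z) (h1.symm.trans h2)
    rw [psCoord_sum, psCoord_sum] at h3
    exact congrFun h3 k
  -- Modulo `T`, the expansion of `Xʲ` reduces to `xʲ`, so `U` reduces to the identity matrix.
  have hdet : IsUnit U.det := by
    rw [PowerSeries.isUnit_iff_constantCoeff, RingHom.map_det]
    have : PowerSeries.constantCoeff.mapMatrix U = 1 := by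
      ext1 j k
      rw [RingHom.mapMatrix_apply, Matrix.map_apply, hU, Matrix.of_apply,
        ← PowerSeries.coeff_zero_eq_constantCoeff_apply, psCoord, PowerSeries.coeff_mk,
        PowerSeries.coeff_zero_eq_constantCoeff_apply, constantCoeff_taylorPS_oreX_pow,
        ← resBasis_apply, Module.Basis.repr_self, Matrix.one_apply, Finsupp.single_apply]
    rw [this, Matrix.det_one]
    exact isUnit_one
  have hWM : W = U⁻¹ * (M * U) := by
    rw [← key, ← mul_assoc, Matrix.nonsing_inv_mul _ hdet, one_mul]
  change W.trace = _
  rw [hWM, Matrix.trace_mul_comm, mul_assoc, Matrix.mul_nonsing_inv _ hdet, mul_one, hM,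
    reducedTrace_eq, Matrix.trace, Matrix.trace, map_sum]
  rfl

/-- The coefficientwise reduced trace of a Taylor expansion is the Taylor expansion of the reduced
trace. -/
theorem resReducedTrace_coeff_taylorPS (τ : AdmissibleIso δ z) (P : OrePoly δ) (n : ℕ) :
    resReducedTrace δ (PowerSeries.coeff n (taylorPS δ τ P)) =
      PowerSeries.coeff n (taylorK δ z (reducedTrace δ P)) := by
  rw [← trace_psCoord_taylorPS δ τ, map_sum, resReducedTrace_eq]
  simp only [psCoord, PowerSeries.coeff_mk, PowerSeries.coeff_C_mul]

/-! ### Residues -/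

theorem support_map_ringHom_subset {A B : Type*} [Ring A] [Ring B] (φ : A →+* B)
    (d : LaurentSeries A) : (d.map φ).support ⊆ d.support := fun _ hk h0 =>
  hk ((congrArg φ h0).trans (map_zero φ))

/-- Coefficientwise application of an additive map that is linear with respect to a ring acting by
multiplication is linear with respect to Laurent series. -/
theorem map_ofLaurent_mul {A B C : Type*} [Ring A] [Ring B] [Ring C] (φ : A →+* B) (ψ : A →+* C)
    (T : B →+ C) (hT : ∀ a b, T (φ a * b) = ψ a * T b) (d : LaurentSeries A) (y : LaurentSeries B) :
    (d.map φ * y).map T = d.map ψ * y.map T := by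
  ext n
  have h : ((d.map φ * y).map T).coeff n = T ((d.map φ * y).coeff n) := rfl
  -- `φ` and `ψ` may kill different coefficients, so both products are summed over the support of
  -- `d`.
  rw [h, HahnSeries.coeff_mul_left' (x := d.map φ) d.isPWO_support (support_map_ringHom_subset φ d),
    HahnSeries.coeff_mul_left' (x := d.map ψ) d.isPWO_support (support_map_ringHom_subset ψ d), map_sum]
  symm
  -- `T` may shrink the support of `y`; the extra index pairs contribute zero.
  refine (Finset.sum_subset (fun ij hij => ?_) fun ij hij hn => ?_).trans
    (Finset.sum_congr rfl fun ij _ => (hT _ _).symm)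
  · rw [Finset.mem_antidiagonal] at hij ⊢
    exact ⟨hij.1, HahnSeries.support_map_subset _ _ hij.2.1, hij.2.2⟩
  · rw [Finset.mem_antidiagonal] at hij hn
    have h0 : (y.map T).coeff ij.2 = 0 := by
      by_contra h0
      exact hn ⟨hij.1, h0, hij.2.2⟩
    rw [h0, mul_zero]

end Taylor

/-! ### Laurent expansions of fractions and their traces. -/

section Residue

open scoped RatFunc

/-- Stated for additive maps so as to cover both the reduced trace and the ring homomorphisms on
coefficients. -/
theorem map_ofPowerSeries {A B : Type*} [Ring A] [Ring B] (T : A →+ B) (p : PowerSeries A)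
    (q : PowerSeries B) (h : ∀ n, T (PowerSeries.coeff n p) = PowerSeries.coeff n q) :
    (HahnSeries.ofPowerSeries ℤ A p).map T = HahnSeries.ofPowerSeries ℤ B q := by
  ext n
  rw [HahnSeries.map_coeff, PowerSeries.coeff_coe, PowerSeries.coeff_coe]
  split_ifs
  · exact map_zero T
  · exact h _

variable {K : Type*} [Field K] (δ : Derivation ℤ K K)
variable {Fs : Type*} [Field Fs] [Algebra (constants δ) Fs] {z : Fs}

variable (z) in
/-- The Laurent expansion `g ↦ g(z + T)` on `F(Y)`. -/
def laurentExp : RatFunc (constants δ) →+* LaurentSeries Fs :=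
  (algebraMap (RatFunc Fs) (LaurentSeries Fs)).comp
    ((RatFunc.laurent z : RatFunc Fs →ₐ[Fs] RatFunc Fs).toRingHom.comp
      (IsFractionRing.map (K := RatFunc (constants δ)) (L := RatFunc Fs)
        (j := Polynomial.mapRingHom (algebraMap (constants δ) Fs))
        (Polynomial.map_injective _ (algebraMap (constants δ) Fs).injective)))

theorem laurentExp_algebraMap (p : (constants δ)[X]) :
    laurentExp δ z (algebraMap _ _ p) = HahnSeries.ofPowerSeries ℤ Fs
      (Polynomial.taylor z (p.map (algebraMap (constants δ) Fs)) : Fs[X]) := by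
  have h : IsFractionRing.map (K := RatFunc (constants δ)) (L := RatFunc Fs)
      (j := Polynomial.mapRingHom (algebraMap (constants δ) Fs))
      (Polynomial.map_injective _ (algebraMap (constants δ) Fs).injective) (algebraMap _ _ p) =
      algebraMap _ _ (p.map (algebraMap (constants δ) Fs)) := IsLocalization.map_eq _ p
  rw [RatFunc.coe_coe, RatFunc.coePolynomial, ← RatFunc.laurent_algebraMap, ← h]
  rfl

theorem zToC_algebraMap (p : (constants δ)[X]) :
    zToC δ (algebraMap _ _ p) =
      algebraMap K[X] (RatFunc K) (p.map (algebraMap (constants δ) K)) := by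
  rw [zToC]
  exact IsLocalization.map_eq _ p

variable [FiniteDimensional (constants δ) K]

theorem taylorSeries_toFrac (τ : AdmissibleIso δ z) (P : OrePoly δ) :
    taylorSeries δ τ (toFrac δ P) = taylorPoly δ τ P :=
  OreLocalization.universalHom_commutes _ _ _

/-- The coefficientwise reduced trace of the Taylor expansion of an element of the skew field of
fractions is the Laurent expansion of its reduced trace. -/
theorem map_resTraceHom_taylorSeries (τ : AdmissibleIso δ z) {f : OreFrac δ}
    {D t : (constants δ)[X]} {P : OrePoly δ} (hD : D ≠ 0)
    (h : toFrac δ (zHom δ D) * f = toFrac δ P)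
    (ht : t.map (algebraMap (constants δ) K) = reducedTrace δ P) :
    (taylorSeries δ τ f).map (resTraceHom δ z) =
      (laurentExp δ z (algebraMap _ _ t / algebraMap _ _ D)).map
        (algebraMap Fs (ScalarExt δ Fs)) := by
  set ψ := algebraMap Fs (ScalarExt δ Fs)
  set d := laurentExp δ z (algebraMap _ _ D) with hd
  have hd0 : d ≠ 0 := by
    rw [hd, map_ne_zero]
    exact RatFunc.algebraMap_ne_zero hD
  have hzD : taylorPoly δ τ (zHom δ D) = d.map (resScalar (z := z) δ) := by
    rw [taylorPoly_zHom, hd, laurentExp_algebraMap]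
    exact (map_ofPowerSeries (resScalar δ : Fs →+* ResRing δ z).toAddMonoidHom _ _
      fun n => (PowerSeries.coeff_map (resScalar δ) n _).symm).symm
  have hP : (taylorPoly δ τ P).map (resTraceHom δ z) =
      (laurentExp δ z (algebraMap _ _ t)).map ψ := by
    rw [laurentExp_algebraMap]
    refine (map_ofPowerSeries (resTraceHom δ z) _ (taylorK δ z (reducedTrace δ P))
      fun n => resReducedTrace_coeff_taylorPS δ τ P n).trans ?_
    rw [← ht, taylorK_map]
    exact (map_ofPowerSeries ψ.toAddMonoidHom _ _
      fun n => (PowerSeries.coeff_map ψ n _).symm).symm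
  have h1 : taylorPoly δ τ (zHom δ D) * taylorSeries δ τ f = taylorPoly δ τ P := by
    rw [← taylorSeries_toFrac, ← taylorSeries_toFrac, ← map_mul, h]
  -- The trace of `D f = P`: the expansion of `D` comes out of the trace because its coefficients
  -- are scalars from `Fˢ`.
  have h2 : d.map ψ * (taylorSeries δ τ f).map (resTraceHom δ z) =
      (laurentExp δ z (algebraMap _ _ t)).map ψ := by
    rw [← hP, ← h1, hzD]
    exact (map_ofLaurent_mul (resScalar δ) ψ (resTraceHom δ z)
      (resReducedTrace_resScalar_mul δ z) d _).symm
  have hmul : ∀ x y : LaurentSeries Fs, (x * y).map ψ = x.map ψ * y.map ψ := fun x y =>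
    HahnSeries.map_mul (ψ : Fs →ₙ+* ScalarExt δ Fs)
  -- The inverse is taken in the field `Fˢ((T))` and then mapped, so nothing is inverted directly in
  -- `Kˢ((T))`.
  have hone : (d⁻¹).map ψ * d.map ψ = 1 := by
    rw [← hmul, inv_mul_cancel₀ hd0]
    ext n
    change ψ ((1 : LaurentSeries Fs).coeff n) = _
    rw [HahnSeries.coeff_one, HahnSeries.coeff_one]
    split_ifs
    · exact map_one ψ
    · exact map_zero ψ
  rw [map_div₀, ← hd, div_eq_inv_mul, hmul, ← h2, ← mul_assoc, hone, one_mul]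

end Residue

end SkewResidue

end

theorem mainTheorem11 {K : Type*} [Field K] (δ : Derivation ℤ K K) (hδ : δ ≠ 0)
    [FiniteDimensional (SkewResidue.constants δ) K]
    {Fs : Type*} [Field Fs] [Algebra (SkewResidue.constants δ) Fs]
    [IsSepClosure (SkewResidue.constants δ) Fs] (f : SkewResidue.OreFrac δ) :
    ∃ g : RatFunc (SkewResidue.constants δ),
      SkewResidue.zToC δ g = SkewResidue.reducedTraceFrac δ f ∧
      ∀ z : Fs,
        (∀ τ : SkewResidue.AdmissibleIso δ z,
          SkewResidue.resReducedTrace δ (SkewResidue.sres δ τ f) =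
            algebraMap Fs (SkewResidue.ScalarExt δ Fs) (SkewResidue.residue δ z g)) ∧
        ∀ τ₁ τ₂ : SkewResidue.AdmissibleIso δ z,
          SkewResidue.resReducedTrace δ (SkewResidue.sres δ τ₁ f) =
            SkewResidue.resReducedTrace δ (SkewResidue.sres δ τ₂ f) := by
  obtain ⟨⟨D, P⟩, hD, h⟩ := SkewResidue.exists_central_denominator δ f
  obtain ⟨t, ht⟩ := SkewResidue.exists_map_eq_reducedTrace δ P
  have hres : ∀ (z : Fs) (τ : SkewResidue.AdmissibleIso δ z),
      SkewResidue.resReducedTrace δ (SkewResidue.sres δ τ f) =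
        algebraMap Fs (SkewResidue.ScalarExt δ Fs)
          (SkewResidue.residue δ z (algebraMap _ _ t / algebraMap _ _ D)) := fun z τ =>
    -- Both the skew residue and the residue are by definition coefficients of `T⁻¹`.
    congrArg (fun s => HahnSeries.coeff s (-1))
      (SkewResidue.map_resTraceHom_taylorSeries δ τ hD h ht)
  refine ⟨algebraMap _ _ t / algebraMap _ _ D, ?_, fun z => ⟨hres z, fun τ₁ τ₂ => ?_⟩⟩
  · rw [SkewResidue.reducedTraceFrac_eq δ hD h, map_div₀,
      SkewResidue.zToC_algebraMap, SkewResidue.zToC_algebraMap, ht]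
  -- The residue on the right-hand side does not involve `τ`.
  · rw [hres z τ₁, hres z τ₂]
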